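/- All spaces are topological spaces and all maps are continuous. Given maps $f\colon B\to X$ and $g\colon C\to X$, a \emph{join of $f$ and $g$ over $X$} is a map $h\colon J\to X$ obtained as follows. Take a homotopy pullback $B\leftarrow F\to C$ of $f$ and $g$, and a homotopy pushout $B\to J\leftarrow C$ of $B\leftarrow F\to C$. Let $h=(f,g)$ be the whisker map induced by this homotopy pushout from the homotopy commutative pullback square. Here homotopy pullbacks and homotopy pushouts are squares with a specified homotopy for which the comparison map to the space of triples $(b,c,\gamma)$, with $\gamma$ a path from $f(b)$ to $g(c)$, respectively from the double mapping cylinder of $B\leftarrow F\to C$, is a homotopy equivalence. The whisker map is characterized up to homotopy by the condition that its composite with the comparison map from the double mapping cylinder is homotopic to the map defined by $f$, $g$ and the homotopy of the pullback square. For a map $\iota_X\colon A\to X$, the \emph{Ganea maps} $g_n(\iota_X)\colon G_n(\iota_X)\to X$, $n\ge 0$, are defined inductively: $g_0(\iota_X)=\iota_X$, and $g_{n+1}(\iota_X)$ is a join of $g_n(\iota_X)$ and $\iota_X$ over $X$. \textbf{Proposition.} For any map $\iota_X\colon A\to X$ and all integers $i,j\ge 0$, $$g_j(g_i(\iota_X))\simeq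 g_{ij+i+j}(\iota_X),$$ that is, whatever choices of homotopy pullbacks, homotopy pushouts and whisker maps are made in the constructions, there is a homotopy equivalence $e\colon G_j(g_i(\iota_X))\to G_{ij+i+j}(\iota_X)$ such that $g_{ij+i+j}(\iota_X)\circ e$ is homotopic to $g_j(g_i(\iota_X))$. -/

import Mathlib

open scoped unitInterval

universe u

namespace Ganea

section Defs

variable {A B F J X : Type u} [TopologicalSpace A] [TopologicalSpace B] [TopologicalSpace F]
  [TopologicalSpace J] [TopologicalSpace X]

/-- A continuous map is a homotopy equivalence if it has a two-sided homotopy inverse. -/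
def IsHomotopyEquiv (f : C(A, B)) : Prop :=
  ∃ e : ContinuousMap.HomotopyEquiv A B, e.toFun = f

/-- The maps `f : A → X` and `g : B → X` are homotopy equivalent over `X`: there is a homotopy
equivalence `e : A → B` such that `g ∘ e` is homotopic to `f`. -/
def HomotopyEquivOver (f : C(A, X)) (g : C(B, X)) : Prop :=
  ∃ e : C(A, B), IsHomotopyEquiv e ∧ (g.comp e).Homotopic f

/-- The standard homotopy pullback of `f : A → X` and `g : B → X`: triples `(a, b, γ)`
where `γ` is a path in `X` from `f a` to `g b` (compact-open topology on paths). -/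
abbrev StdPullback (f : C(A, X)) (g : C(B, X)) : Type u :=
  { p : A × B × C(I, X) // p.2.2 0 = f p.1 ∧ p.2.2 1 = g p.2.1 }

/-- The map from `F` to the standard homotopy pullback given by a homotopy commutative square,
`x ↦ (p x, q x, K(-, x))`. -/
def toStdPullback {f : C(A, X)} {g : C(B, X)} {p : C(F, A)} {q : C(F, B)}
    (K : (f.comp p).Homotopy (g.comp q)) : C(F, StdPullback f g) where
  toFun x := ⟨(p x, q x, (K.toContinuousMap.comp ContinuousMap.prodSwap).curry x), by simp⟩
  continuous_toFun := by fun_prop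

/-- A square `f ∘ p ≃ g ∘ q`, commuting up to the homotopy `K`, is a homotopy pullback if the
induced map to the standard homotopy pullback is a homotopy equivalence. -/
def IsHomotopyPullback {f : C(A, X)} {g : C(B, X)} {p : C(F, A)} {q : C(F, B)}
    (K : (f.comp p).Homotopy (g.comp q)) : Prop :=
  IsHomotopyEquiv (toStdPullback K)

/-- The gluing relation of the double mapping cylinder on `A ⊔ (F × I) ⊔ B`:
`(x, 0) ∼ p x` and `(x, 1) ∼ q x`. -/
inductive CylRel (p : C(F, A)) (q : C(F, B)) : A ⊕ (F × I) ⊕ B → A ⊕ (F × I) ⊕ B → Prop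
  | left (x : F) : CylRel p q (Sum.inr (Sum.inl (x, 0))) (Sum.inl (p x))
  | right (x : F) : CylRel p q (Sum.inr (Sum.inl (x, 1))) (Sum.inr (Sum.inr (q x)))

/-- The standard homotopy pushout of `A ← F → B`: the double mapping cylinder, with the quotient
topology. -/
abbrev StdPushout (p : C(F, A)) (q : C(F, B)) : Type u :=
  Quot (CylRel p q)

/-- The map `(u, K, v)` from the double mapping cylinder of `p` and `q` to `J` induced by maps
`u : A → J`, `v : B → J` and a homotopy `K` from `u ∘ p` to `v ∘ q`. -/
def fromStdPushout {p : C(F, A)} {q : C(F, B)} {u : C(A, J)} {v : C(B, J)}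
    (K : (u.comp p).Homotopy (v.comp q)) : C(StdPushout p q, J) where
  toFun := Quot.lift (Sum.elim u (Sum.elim (fun z => K (z.2, z.1)) v)) (by
    rintro _ _ (x | x) <;> simp)
  continuous_toFun := by
    refine continuous_quot_lift _ ?_
    refine u.continuous.sumElim (Continuous.sumElim ?_ v.continuous)
    fun_prop

/-- A square `u ∘ p ≃ v ∘ q`, commuting up to the homotopy `H`, is a homotopy pushout if the
induced map from the double mapping cylinder is a homotopy equivalence. -/
def IsHomotopyPushout {p : C(F, A)} {q : C(F, B)} {u : C(A, J)} {v : C(B, J)}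
    (H : (u.comp p).Homotopy (v.comp q)) : Prop :=
  IsHomotopyEquiv (fromStdPushout H)

/-- `h` is a whisker map out of the square `u ∘ p ≃ v ∘ q` (filled by `H`) induced by
the square `f ∘ p ≃ g ∘ q` (filled by `K`). A homotopy on the double mapping cylinder amounts to
homotopies `h ∘ u ≃ f` and `h ∘ v ≃ g` that are compatible with `H` and `K`. -/
def IsWhiskerMap {p : C(F, A)} {q : C(F, B)} {u : C(A, J)} {v : C(B, J)}
    (H : (u.comp p).Homotopy (v.comp q)) {f : C(A, X)} {g : C(B, X)}
    (K : (f.comp p).Homotopy (g.comp q)) (h : C(J, X)) : Prop :=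
  (h.comp (fromStdPushout H)).Homotopic (fromStdPushout K)

/-- `h : J → X` is a join over `X` of `f : A → X` and `g : B → X`: there are a homotopy pullback
`F` of `f` and `g` and a homotopy pushout square `A ← F → B` with corner `J`, and `h` is the
whisker map `(f, g)` induced by this homotopy pushout. -/
def IsJoin (f : C(A, X)) (g : C(B, X)) (h : C(J, X)) : Prop :=
  ∃ (F : Type u) (_ : TopologicalSpace F) (p : C(F, A)) (q : C(F, B)) (u : C(A, J)) (v : C(B, J))
    (K : (f.comp p).Homotopy (g.comp q)) (H : (u.comp p).Homotopy (v.comp q)),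
    IsHomotopyPullback K ∧ IsHomotopyPushout H ∧ IsWhiskerMap H K h

end Defs

/-- `IsGaneaMap ι n g`: the map `g : G → X` is an `n`-th Ganea map of `ι : A → X`, that is,
the map `g_n` in some Ganea construction of `ι`: a sequence of maps to `X` that starts with
`g_0 = ι` and in which `g_{n+1}` is a join of `g_n` and `ι` over `X`. -/
inductive IsGaneaMap {A X : Type u} [TopologicalSpace A] [TopologicalSpace X] (ι : C(A, X)) :
    ℕ → ∀ {G : Type u} [TopologicalSpace G], C(G, X) → Prop
  | zero : IsGaneaMap ι 0 ι
  | succ {n : ℕ} {G G' : Type u} [TopologicalSpace G] [TopologicalSpace G'] {g : C(G, X)}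
      {g' : C(G', X)} : IsGaneaMap ι n g → IsJoin g ι g' → IsGaneaMap ι (n + 1) g'

section Existence

variable {A B F X : Type u} [TopologicalSpace A] [TopologicalSpace B] [TopologicalSpace F]
  [TopologicalSpace X]

theorem isHomotopyEquiv_id : IsHomotopyEquiv (ContinuousMap.id A) :=
  ⟨ContinuousMap.HomotopyEquiv.refl A, rfl⟩

/-- The tautological homotopy on the standard homotopy pullback. -/
def stdPullbackHomotopy (f : C(A, X)) (g : C(B, X)) :
    (f.comp ⟨fun z : StdPullback f g => z.1.1, by fun_prop⟩).Homotopy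
      (g.comp ⟨fun z : StdPullback f g => z.1.2.1, by fun_prop⟩) where
  toFun z := z.2.1.2.2 z.1
  continuous_toFun := by fun_prop
  map_zero_left z := z.2.1
  map_one_left z := z.2.2

/-- The tautological homotopy on the double mapping cylinder. -/
def stdPushoutHomotopy (p : C(F, A)) (q : C(F, B)) :
    ((⟨fun a => Quot.mk _ (Sum.inl a), continuous_quot_mk.comp continuous_inl⟩ :
        C(A, StdPushout p q)).comp p).Homotopy
      ((⟨fun b => Quot.mk _ (Sum.inr (Sum.inr b)),
        continuous_quot_mk.comp (continuous_inr.comp continuous_inr)⟩ :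
        C(B, StdPushout p q)).comp q) where
  toFun z := Quot.mk _ (Sum.inr (Sum.inl (z.2, z.1)))
  continuous_toFun :=
    continuous_quot_mk.comp (continuous_inr.comp (continuous_inl.comp continuous_swap))
  map_zero_left x := Quot.sound (CylRel.left x)
  map_one_left x := Quot.sound (CylRel.right x)

/-- Joins over `X` exist. -/
theorem exists_isJoin (f : C(A, X)) (g : C(B, X)) :
    ∃ (J : Type u) (_ : TopologicalSpace J) (h : C(J, X)), IsJoin f g h := by
  refine ⟨StdPushout _ _, inferInstance, fromStdPushout (stdPullbackHomotopy f g),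
    StdPullback f g, inferInstance, _, _, _, _, stdPullbackHomotopy f g,
    stdPushoutHomotopy _ _, ?_, ?_, ?_⟩
  · exact isHomotopyEquiv_id
  · have : fromStdPushout (stdPushoutHomotopy
        (⟨fun z : StdPullback f g => z.1.1, by fun_prop⟩ : C(StdPullback f g, A))
        (⟨fun z : StdPullback f g => z.1.2.1, by fun_prop⟩ : C(StdPullback f g, B))) =
        ContinuousMap.id _ := by
      ext z
      rcases z with ⟨a | z | b⟩ <;> rfl
    unfold IsHomotopyPushout
    rw [this]
    exact isHomotopyEquiv_id
  · have : ∀ k l : C(StdPushout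
        (⟨fun z : StdPullback f g => z.1.1, by fun_prop⟩ : C(StdPullback f g, A))
        (⟨fun z : StdPullback f g => z.1.2.1, by fun_prop⟩ : C(StdPullback f g, B)), X),
        k = l → k.Homotopic l := fun k l h => h ▸ ContinuousMap.Homotopic.refl k
    apply this
    ext z
    rcases z with ⟨a | z | b⟩ <;> rfl

/-- Every map has Ganea maps of every order. -/
theorem exists_isGaneaMap (ι : C(A, X)) (n : ℕ) :
    ∃ (G : Type u) (_ : TopologicalSpace G) (g : C(G, X)), IsGaneaMap ι n g := by
  induction n with
  | zero => exact ⟨A, inferInstance, ι, .zero⟩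
  | succ n ih =>
    obtain ⟨G, _, g, hg⟩ := ih
    obtain ⟨J, _, h, hh⟩ := exists_isJoin g ι
    exact ⟨J, inferInstance, h, .succ hg hh⟩

end Existence

end Ganea

/-! Up to homotopy equivalence over `X`, the map `g_n(ι)` is the join of `n + 1` copies of `ι`.
Hence `g_j(g_i(ι))` is a join of `(i + 1)(j + 1) = (ij + i + j) + 1` copies, bracketed differently,
and the claim reduces to two facts: the join depends only on its factors up to equivalence over `X`,
and it is associative.

Both facts are proved on a strict model. For fibrations `p` and `q` over `X`, `FibJoin p q` consists
of a parameter `t` and two points in a common fibre, the first forgotten at `t = 1` and the second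
at `t = 0`. It carries the coarse topology, so maps into it are tested on components. The projection
is again a fibration (`IsFib.fibJoin`), the construction preserves fibre homotopy equivalences
(`FibEquiv.fibJoin`), and it is associative up to homeomorphism over `X` (`FibJoin.fibEquiv_assoc`).
Dold's theorem (`IsFib.fibEquiv`) turns homotopy equivalences over `X` between fibrations into fibre
homotopy equivalences, which can then be joined with further factors.

The link with arbitrary joins is `IsJoin.homotopyEquivOver`. The double mapping cylinder is
invariant under equivalences of its middle space (`StdPushout.isHomotopyEquiv_mapMid`), so any
choice of pullback and pushout may be replaced by the standard one. That one is compared with the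
strict join of path fibrations by cutting a path from `f a` to `g b` at time `t`, and conversely by
concatenating the two pieces. -/

namespace Ganea

/-! ### Homotopy equivalences, absolute and over a base -/

section HomotopyEquivalences

variable {A B C X : Type*} [TopologicalSpace A] [TopologicalSpace B] [TopologicalSpace C]
  [TopologicalSpace X]

theorem Homotopic.of_eq {f g : C(A, B)} (h : f = g) : f.Homotopic g :=
  h ▸ ContinuousMap.Homotopic.refl f

theorem Homotopic.comp_left {f g : C(A, B)} (k : C(B, C)) (h : f.Homotopic g) :
    (k.comp f).Homotopic (k.comp g) :=
  (ContinuousMap.Homotopic.refl k).comp h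

theorem Homotopic.comp_right {f g : C(B, C)} (h : f.Homotopic g) (k : C(A, B)) :
    (f.comp k).Homotopic (g.comp k) :=
  h.comp (ContinuousMap.Homotopic.refl k)

end HomotopyEquivalences

section HomotopyEquivalences

variable {A B C X : Type u} [TopologicalSpace A] [TopologicalSpace B] [TopologicalSpace C]
  [TopologicalSpace X]

theorem isHomotopyEquiv_iff {f : C(A, B)} : IsHomotopyEquiv f ↔ ∃ g : C(B, A),
    (g.comp f).Homotopic (ContinuousMap.id A) ∧ (f.comp g).Homotopic (ContinuousMap.id B) := by
  constructor
  · rintro ⟨e, rfl⟩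
    exact ⟨e.invFun, e.left_inv, e.right_inv⟩
  · rintro ⟨g, h₁, h₂⟩
    exact ⟨⟨f, g, h₁, h₂⟩, rfl⟩

theorem IsHomotopyEquiv.of_homotopic {f g : C(A, B)} (hf : IsHomotopyEquiv f)
    (h : f.Homotopic g) : IsHomotopyEquiv g := by
  obtain ⟨k, h₁, h₂⟩ := isHomotopyEquiv_iff.1 hf
  exact isHomotopyEquiv_iff.2 ⟨k, (Homotopic.comp_left k h.symm).trans h₁,
    (Homotopic.comp_right h.symm k).trans h₂⟩

theorem IsHomotopyEquiv.comp {g : C(B, C)} {f : C(A, B)} (hg : IsHomotopyEquiv g)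
    (hf : IsHomotopyEquiv f) : IsHomotopyEquiv (g.comp f) := by
  obtain ⟨e, rfl⟩ := hg
  obtain ⟨e', rfl⟩ := hf
  exact ⟨e'.trans e, rfl⟩

/-- A map with a left and a right homotopy inverse is a homotopy equivalence. -/
theorem isHomotopyEquiv_of_inverses {f : C(A, B)} {l r : C(B, A)}
    (hl : (l.comp f).Homotopic (ContinuousMap.id A))
    (hr : (f.comp r).Homotopic (ContinuousMap.id B)) : IsHomotopyEquiv f := by
  refine isHomotopyEquiv_iff.2 ⟨r, ?_, hr⟩
  have : r.Homotopic l :=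
    (Homotopic.comp_right hl.symm r).trans (Homotopic.comp_left l hr)
  exact (Homotopic.comp_right this f).trans hl

theorem IsHomotopyEquiv.of_comp_left {g : C(B, C)} {f : C(A, B)} (hg : IsHomotopyEquiv g)
    (hgf : IsHomotopyEquiv (g.comp f)) : IsHomotopyEquiv f := by
  obtain ⟨g', h₁, h₂⟩ := isHomotopyEquiv_iff.1 hg
  obtain ⟨k, h₃, h₄⟩ := isHomotopyEquiv_iff.1 hgf
  refine isHomotopyEquiv_iff.2 ⟨k.comp g, h₃, ?_⟩
  have e₁ : (f.comp (k.comp g)).Homotopic ((g'.comp g).comp (f.comp (k.comp g))) :=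
    Homotopic.comp_right h₁.symm (f.comp (k.comp g))
  exact (e₁.trans (Homotopic.comp_left g' (Homotopic.comp_right h₄ g))).trans h₁

theorem IsHomotopyEquiv.of_comp_right {g : C(B, C)} {f : C(A, B)} (hf : IsHomotopyEquiv f)
    (hgf : IsHomotopyEquiv (g.comp f)) : IsHomotopyEquiv g := by
  obtain ⟨f', h₁, h₂⟩ := isHomotopyEquiv_iff.1 hf
  have : IsHomotopyEquiv ((g.comp f).comp f') := hgf.comp (isHomotopyEquiv_iff.2 ⟨f, h₂, h₁⟩)
  exact this.of_homotopic (Homotopic.comp_left g h₂)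

/-- The two-out-of-six property, for the last map. -/
theorem IsHomotopyEquiv.of_two_out_of_six {D : Type u} [TopologicalSpace D] {h : C(C, D)}
    {g : C(B, C)} {f : C(A, B)} (hhg : IsHomotopyEquiv (h.comp g))
    (hgf : IsHomotopyEquiv (g.comp f)) : IsHomotopyEquiv h := by
  obtain ⟨k, h₁, -⟩ := isHomotopyEquiv_iff.1 hhg
  obtain ⟨l, -, h₂⟩ := isHomotopyEquiv_iff.1 hgf
  exact (isHomotopyEquiv_of_inverses (l := k.comp h) (r := f.comp l) h₁ h₂).of_comp_right hhg

theorem HomotopyEquivOver.refl (f : C(A, X)) : HomotopyEquivOver f f :=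
  ⟨ContinuousMap.id A, isHomotopyEquiv_id, ContinuousMap.Homotopic.refl _⟩

theorem HomotopyEquivOver.trans {f : C(A, X)} {g : C(B, X)} {h : C(C, X)}
    (hfg : HomotopyEquivOver f g) (hgh : HomotopyEquivOver g h) : HomotopyEquivOver f h := by
  obtain ⟨e, he, h₁⟩ := hfg
  obtain ⟨e', he', h₂⟩ := hgh
  exact ⟨e'.comp e, he'.comp he, (Homotopic.comp_right h₂ e).trans h₁⟩

theorem HomotopyEquivOver.symm {f : C(A, X)} {g : C(B, X)}
    (hfg : HomotopyEquivOver f g) : HomotopyEquivOver g f := by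
  obtain ⟨e, he, h⟩ := hfg
  obtain ⟨e', h₁, h₂⟩ := isHomotopyEquiv_iff.1 he
  exact ⟨e', isHomotopyEquiv_iff.2 ⟨e, h₂, h₁⟩,
    (Homotopic.comp_right h.symm e').trans (Homotopic.comp_left g h₂)⟩

end HomotopyEquivalences

/-- Clamping of a real number to the unit interval. -/
noncomputable def clampI (r : ℝ) : I := Set.projIcc 0 1 zero_le_one r

@[fun_prop]
theorem continuous_clampI : Continuous clampI := continuous_projIcc (h := zero_le_one)

theorem coe_clampI (r : ℝ) : (clampI r : ℝ) = max 0 (min 1 r) := rfl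

theorem clampI_of_nonpos {r : ℝ} (h : r ≤ 0) : clampI r = 0 := Set.projIcc_of_le_left _ h

theorem clampI_of_one_le {r : ℝ} (h : 1 ≤ r) : clampI r = 1 := Set.projIcc_of_right_le _ h

@[simp]
theorem clampI_coe (t : I) : clampI t = t := Set.projIcc_val zero_le_one t

@[simp]
theorem clampI_zero : clampI 0 = 0 := clampI_of_nonpos le_rfl

@[simp]
theorem clampI_one : clampI 1 = 1 := clampI_of_one_le le_rfl

/-! ### Double mapping cylinders and their invariance in the middle space -/

section StdPushout

variable {A B F P X Z : Type u} [TopologicalSpace A] [TopologicalSpace B] [TopologicalSpace F]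
  [TopologicalSpace P] [TopologicalSpace X] [TopologicalSpace Z]

namespace StdPushout

/-- The inclusion of the left end of the double mapping cylinder. -/
def inl (p : C(F, A)) (q : C(F, B)) : C(A, StdPushout p q) :=
  ⟨fun a => Quot.mk _ (Sum.inl a), continuous_quot_mk.comp continuous_inl⟩

/-- The inclusion of the right end of the double mapping cylinder. -/
def inr (p : C(F, A)) (q : C(F, B)) : C(B, StdPushout p q) :=
  ⟨fun b => Quot.mk _ (Sum.inr (Sum.inr b)),
    continuous_quot_mk.comp (continuous_inr.comp continuous_inr)⟩

/-- The cylinder part of the double mapping cylinder. -/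
def mid (p : C(F, A)) (q : C(F, B)) : C(F × I, StdPushout p q) :=
  ⟨fun z => Quot.mk _ (Sum.inr (Sum.inl z)),
    continuous_quot_mk.comp (continuous_inr.comp continuous_inl)⟩

@[simp]
theorem mid_zero (p : C(F, A)) (q : C(F, B)) (x : F) : mid p q (x, 0) = inl p q (p x) :=
  Quot.sound (CylRel.left x)

@[simp]
theorem mid_one (p : C(F, A)) (q : C(F, B)) (x : F) : mid p q (x, 1) = inr p q (q x) :=
  Quot.sound (CylRel.right x)

theorem ind {p : C(F, A)} {q : C(F, B)} {motive : StdPushout p q → Prop}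
    (hl : ∀ a, motive (inl p q a)) (hm : ∀ x t, motive (mid p q (x, t)))
    (hr : ∀ b, motive (inr p q b)) (z : StdPushout p q) : motive z := by
  rcases z with ⟨a | ⟨x, t⟩ | b⟩
  exacts [hl a, hm x t, hr b]

/-- The map out of the double mapping cylinder given by maps on its three parts. -/
def desc {p : C(F, A)} {q : C(F, B)} (u : C(A, Z)) (m : C(F × I, Z)) (v : C(B, Z))
    (h₀ : ∀ x, m (x, 0) = u (p x)) (h₁ : ∀ x, m (x, 1) = v (q x)) : C(StdPushout p q, Z) where
  toFun := Quot.lift (Sum.elim u (Sum.elim m v)) (by rintro _ _ (x | x) <;> simp [h₀, h₁])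
  continuous_toFun := continuous_quot_lift _
    (u.continuous.sumElim (m.continuous.sumElim v.continuous))

section desc

variable {p : C(F, A)} {q : C(F, B)} (u : C(A, Z)) (m : C(F × I, Z)) (v : C(B, Z))
    (h₀ : ∀ x, m (x, 0) = u (p x)) (h₁ : ∀ x, m (x, 1) = v (q x))

@[simp]
theorem desc_inl (a : A) : desc u m v h₀ h₁ (inl p q a) = u a := rfl

@[simp]
theorem desc_mid (z : F × I) : desc u m v h₀ h₁ (mid p q z) = m z := rfl

@[simp]
theorem desc_inr (b : B) : desc u m v h₀ h₁ (inr p q b) = v b := rfl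

end desc

/-- Maps out of the double mapping cylinder that agree on both ends are homotopic if they are
homotopic on the cylinder part relative to the ends. -/
theorem homotopic_of_rel_ends {p : C(F, A)} {q : C(F, B)} {k l : C(StdPushout p q, Z)}
    (m : C(I × F × I, Z)) (hl : ∀ a, k (inl p q a) = l (inl p q a))
    (hr : ∀ b, k (inr p q b) = l (inr p q b))
    (h₀ : ∀ τ x, m (τ, x, 0) = k (inl p q (p x))) (h₁ : ∀ τ x, m (τ, x, 1) = k (inr p q (q x)))
    (hk : ∀ x t, m (0, x, t) = k (mid p q (x, t)))
    (hl' : ∀ x t, m (1, x, t) = l (mid p q (x, t))) : k.Homotopic l := by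
  -- The homotopy is built as a map into the path space `C(I, Z)`, so only the universal property of
  -- the cylinder itself is needed, not that of its product with `I`.
  let Φ : C(StdPushout p q, C(I, Z)) := desc (ContinuousMap.const'.comp (k.comp (inl p q)))
    ((m.comp ContinuousMap.prodSwap).curry) (ContinuousMap.const'.comp (k.comp (inr p q)))
    (fun x => by ext τ; simp [h₀]) (fun x => by ext τ; simp [h₁])
  refine ⟨⟨⟨fun z => Φ z.2 z.1, by fun_prop⟩, ?_, ?_⟩⟩
  · intro z
    induction z using ind with
    | hl a => simp [Φ]
    | hm x t => simp [Φ, hk]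
    | hr b => simp [Φ]
  · intro z
    induction z using ind with
    | hl a => simp [Φ, hl]
    | hm x t => simp [Φ, hl']
    | hr b => simp [Φ, hr]

/-- The map of double mapping cylinders induced by a map `φ` of the middle spaces. -/
def mapMid (p : C(P, A)) (q : C(P, B)) (φ : C(F, P)) :
    C(StdPushout (p.comp φ) (q.comp φ), StdPushout p q) :=
  desc (inl p q) ((mid p q).comp (φ.prodMap (ContinuousMap.id I))) (inr p q) (by simp) (by simp)

theorem mapMid_comp {F' : Type u} [TopologicalSpace F'] (p : C(P, A)) (q : C(P, B)) (φ : C(F, P))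
    (ψ : C(F', F)) : (mapMid p q φ).comp (mapMid (p.comp φ) (q.comp φ) ψ) =
      mapMid p q (φ.comp ψ) := by
  ext z
  induction z using ind <;> rfl

theorem mapMid_id (p : C(P, A)) (q : C(P, B)) :
    mapMid p q (ContinuousMap.id P) = ContinuousMap.id _ := by
  ext z
  induction z using ind <;> rfl

end StdPushout

end StdPushout

namespace StdPushout

variable {A B F P : Type u} [TopologicalSpace A] [TopologicalSpace B] [TopologicalSpace F]
  [TopologicalSpace P]

/-- The inclusion of `F` in the cylinder `F × I` at height `ε`. -/
def cylIncl (F : Type u) [TopologicalSpace F] (ε : I) : C(F, F × I) :=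
  ⟨fun x => (x, ε), by fun_prop⟩

@[simp]
theorem cylIncl_apply (ε : I) (x : F) : cylIncl F ε x = (x, ε) := rfl

open Classical in
/-- The cylinder part of a homotopy inverse to `mapMid R S (cylIncl F ε)`. -/
noncomputable def retractMid (R : C(F × I, A)) (S : C(F × I, B)) (ε : I) :
    C((F × I) × I, StdPushout (R.comp (cylIncl F ε)) (S.comp (cylIncl F ε))) where
  toFun z := if (z.2 : ℝ) ≤ 1 / 3 then
      inl _ _ (R (z.1.1, clampI (ε + (1 - 3 * z.2) * (z.1.2 - ε))))
    else if (z.2 : ℝ) ≤ 2 / 3 then mid _ _ (z.1.1, clampI (3 * z.2 - 1))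
    else inr _ _ (S (z.1.1, clampI (ε + (3 * z.2 - 2) * (z.1.2 - ε))))
  continuous_toFun := by
    refine Continuous.if_le (by fun_prop) (Continuous.if_le (by fun_prop) (by fun_prop)
      (by fun_prop) (by fun_prop) ?_) (by fun_prop) (by fun_prop) ?_
    · rintro ⟨⟨x, s⟩, t⟩ h
      dsimp only at h ⊢
      rw [h]; norm_num [cylIncl]
    · rintro ⟨⟨x, s⟩, t⟩ h
      dsimp only at h ⊢
      rw [h]; norm_num [cylIncl]

/-- The inverse sends the segment over `(x, s)` to a path in three thirds: along `R` from `(x, s)`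
to `(x, ε)`, across the cylinder over `x`, then along `S` back from `(x, ε)` to `(x, s)`. One
composite is a reparametrisation of the cylinder coordinate; the other also moves the coordinate
`s`. -/
theorem isHomotopyEquiv_mapMid_cylIncl (R : C(F × I, A)) (S : C(F × I, B)) (ε : I) :
    IsHomotopyEquiv (mapMid R S (cylIncl F ε)) := by
  let κ : C(StdPushout R S, StdPushout (R.comp (cylIncl F ε)) (S.comp (cylIncl F ε))) :=
    desc (inl _ _) (retractMid R S ε) (inr _ _)
      (by rintro ⟨x, s⟩; norm_num [retractMid]) (by rintro ⟨x, s⟩; norm_num [retractMid])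
  have hκ : ∀ x s t, κ (mid R S ((x, s), t)) = retractMid R S ε ((x, s), t) := fun _ _ _ => rfl
  refine isHomotopyEquiv_iff.2 ⟨κ, ?_, ?_⟩
  · refine homotopic_of_rel_ends
      ⟨fun z => mid _ _ (z.2.1, clampI ((1 - z.1) * clampI (3 * z.2.2 - 1) + z.1 * z.2.2)),
        by fun_prop⟩ (fun a => rfl) (fun a => rfl) ?_ ?_ ?_ ?_
    · intro τ x
      norm_num [κ, mapMid, clampI_of_nonpos]
    · intro τ x
      have h : clampI 2 = 1 := clampI_of_one_le (by norm_num)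
      norm_num [κ, mapMid, h]
    · intro x t
      change _ = retractMid R S ε ((x, ε), t)
      simp only [retractMid, ContinuousMap.coe_mk]
      split_ifs with h₁ h₂
      · have : clampI (3 * (t : ℝ) - 1) = 0 := clampI_of_nonpos (by linarith)
        simp [this]
      · simp
      · have : clampI (3 * (t : ℝ) - 1) = 1 := clampI_of_one_le (by linarith)
        simp [this]
    · intro x t
      simp
  -- The sum of the two maxima is `1` at both ends and `0` on the middle third. Hence `s` never
  -- moves at the ends, while at time `0` it follows the three thirds of `retractMid`.
  · refine homotopic_of_rel_ends
      ⟨fun z => mid _ _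
        ((z.2.1.1, clampI (ε + ((1 - z.1) *
          (max (1 - 3 * (z.2.2 : ℝ)) 0 + max (3 * (z.2.2 : ℝ) - 2) 0) + z.1) * (z.2.1.2 - ε))),
          clampI ((1 - z.1) * clampI (3 * z.2.2 - 1) + z.1 * z.2.2)),
        by fun_prop⟩ (fun a => rfl) (fun a => rfl) ?_ ?_ ?_ ?_
    · rintro τ ⟨x, s⟩
      norm_num [κ, mapMid, clampI_of_nonpos]
    · rintro τ ⟨x, s⟩
      have h : clampI 2 = 1 := clampI_of_one_le (by norm_num)
      norm_num [κ, mapMid, h]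
    · rintro ⟨x, s⟩ t
      rw [ContinuousMap.comp_apply, hκ]
      simp only [retractMid, ContinuousMap.coe_mk]
      split_ifs with h₁ h₂
      · have : clampI (3 * (t : ℝ) - 1) = 0 := clampI_of_nonpos (by linarith)
        have h₃ : max (1 - 3 * (t : ℝ)) 0 = 1 - 3 * t := max_eq_left (by linarith)
        have h₄ : max (3 * (t : ℝ) - 2) 0 = 0 := max_eq_right (by linarith)
        simp [this, mapMid, h₃, h₄]
      · have h₃ : max (1 - 3 * (t : ℝ)) 0 = 0 := max_eq_right (by linarith)
        have h₄ : max (3 * (t : ℝ) - 2) 0 = 0 := max_eq_right (by linarith)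
        simp [mapMid, h₃, h₄]
      · have : clampI (3 * (t : ℝ) - 1) = 1 := clampI_of_one_le (by linarith)
        have h₃ : max (1 - 3 * (t : ℝ)) 0 = 0 := max_eq_right (by linarith)
        have h₄ : max (3 * (t : ℝ) - 2) 0 = 3 * t - 2 := max_eq_left (by linarith)
        simp [this, mapMid, h₃, h₄]
    · rintro ⟨x, s⟩ t
      simp

/-- A homotopy `G'` on `P × I` restricts to `θ` at height `0` and to the identity at height `1`.
Both inclusions of `P` induce equivalences; height `1` shows that `G'` does too, and then height `0`
gives the claim for `θ`. -/
theorem isHomotopyEquiv_mapMid_of_homotopic_id (p : C(P, A)) (q : C(P, B)) {θ : C(P, P)}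
    (h : θ.Homotopic (ContinuousMap.id P)) : IsHomotopyEquiv (mapMid p q θ) := by
  obtain ⟨G⟩ := h
  let G' : C(P × I, P) := G.toContinuousMap.comp ContinuousMap.prodSwap
  have h₁ : G'.comp (cylIncl P 1) = ContinuousMap.id P := by ext x; simp [G']
  have h₀ : θ = G'.comp (cylIncl P 0) := by ext x; simp [G']
  have hid : IsHomotopyEquiv (mapMid p q (G'.comp (cylIncl P 1))) := by
    rw [h₁, mapMid_id]
    exact isHomotopyEquiv_id
  rw [← mapMid_comp] at hid
  have hG := (isHomotopyEquiv_mapMid_cylIncl (p.comp G') (q.comp G') 1).of_comp_right hid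
  rw [h₀, ← mapMid_comp]
  exact hG.comp (isHomotopyEquiv_mapMid_cylIncl (p.comp G') (q.comp G') 0)

/-- The double mapping cylinder is invariant under homotopy equivalences of the middle space. -/
theorem isHomotopyEquiv_mapMid (p : C(P, A)) (q : C(P, B)) {φ : C(F, P)}
    (h : IsHomotopyEquiv φ) : IsHomotopyEquiv (mapMid p q φ) := by
  obtain ⟨ψ, h₁, h₂⟩ := isHomotopyEquiv_iff.1 h
  -- The map induced by `ψ` starts at the cylinder with legs `p ∘ φ ∘ ψ` and `q ∘ φ ∘ ψ`, not `p`
  -- and `q`, so it is not directly an inverse. Two-out-of-six for the chain `φ`, `ψ`, `φ` avoids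
  -- identifying these cylinders.
  refine IsHomotopyEquiv.of_two_out_of_six (g := mapMid (p.comp φ) (q.comp φ) ψ)
    (f := mapMid ((p.comp φ).comp ψ) ((q.comp φ).comp ψ) φ) ?_ ?_
  · rw [mapMid_comp]
    exact isHomotopyEquiv_mapMid_of_homotopic_id p q h₂
  · rw [mapMid_comp]
    exact isHomotopyEquiv_mapMid_of_homotopic_id (p.comp φ) (q.comp φ) h₁

end StdPushout

/-! ### Hurewicz fibrations, Dold's theorem and the path fibration -/

section Fibrations

variable {E E' E'' A B X : Type u} [TopologicalSpace E] [TopologicalSpace E']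
  [TopologicalSpace E''] [TopologicalSpace A] [TopologicalSpace B] [TopologicalSpace X]

/-- Hurewicz fibrations: maps with the homotopy lifting property. -/
def IsFib (p : C(E, X)) : Prop :=
  ∀ (Z : Type u) [TopologicalSpace Z] (g : C(Z, E)) (H : C(I × Z, X)),
    (∀ z, H (0, z) = p (g z)) → ∃ K : C(I × Z, E), (∀ z, K (0, z) = g z) ∧ ∀ y, p (K y) = H y

/-- Vertical homotopy, with respect to `p`, of maps to the source of `p`. -/
def HomotopicOver (p : C(E', X)) (φ φ' : C(E, E')) : Prop :=
  ∃ K : φ.Homotopy φ', ∀ τ z, p (K (τ, z)) = p (φ z)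

namespace HomotopicOver

variable {p : C(E', X)} {φ φ' φ'' : C(E, E')}

theorem mk (K : C(I × E, E')) (h₀ : ∀ z, K (0, z) = φ z) (h₁ : ∀ z, K (1, z) = φ' z)
    (h : ∀ τ z, p (K (τ, z)) = p (φ z)) : HomotopicOver p φ φ' :=
  ⟨⟨K, h₀, h₁⟩, h⟩

theorem homotopic (h : HomotopicOver p φ φ') : φ.Homotopic φ' := ⟨h.choose⟩

theorem proj_eq (h : HomotopicOver p φ φ') (z : E) : p (φ' z) = p (φ z) := by
  obtain ⟨K, hK⟩ := h
  simpa using hK 1 z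

theorem of_eq (p : C(E', X)) (h : φ = φ') : HomotopicOver p φ φ' := by
  subst h
  exact ⟨ContinuousMap.Homotopy.refl φ, fun τ z => rfl⟩

theorem symm (h : HomotopicOver p φ φ') : HomotopicOver p φ' φ := by
  have h' := h.proj_eq
  obtain ⟨K, hK⟩ := h
  exact ⟨K.symm, fun τ z => by simp [ContinuousMap.Homotopy.symm_apply, hK, h']⟩

theorem trans (h : HomotopicOver p φ φ') (h' : HomotopicOver p φ' φ'') :
    HomotopicOver p φ φ'' := by
  have h'' := h.proj_eq
  obtain ⟨K, hK⟩ := h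
  obtain ⟨K', hK'⟩ := h'
  refine ⟨K.trans K', fun τ z => ?_⟩
  rw [ContinuousMap.Homotopy.trans_apply]
  split_ifs
  · exact hK _ z
  · exact (hK' _ z).trans (h'' z)

theorem comp_right (h : HomotopicOver p φ φ') (k : C(E'', E)) :
    HomotopicOver p (φ.comp k) (φ'.comp k) := by
  obtain ⟨K, hK⟩ := h
  exact mk ⟨fun z => K (z.1, k z.2), by fun_prop⟩ (by simp) (by simp) fun τ z => hK τ (k z)

theorem comp_left (h : HomotopicOver p φ φ') {p' : C(E'', X)} {k : C(E', E'')}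
    (hk : ∀ e, p' (k e) = p e) : HomotopicOver p' (k.comp φ) (k.comp φ') := by
  obtain ⟨K, hK⟩ := h
  exact mk ⟨fun z => k (K z), by fun_prop⟩ (by simp) (by simp)
    fun τ z => by simpa [hk] using hK τ z

end HomotopicOver

/-- Fibre homotopy equivalence of spaces over `X`. -/
def FibEquiv (p : C(E, X)) (p' : C(E', X)) : Prop :=
  ∃ (φ : C(E, E')) (ψ : C(E', E)), (∀ e, p' (φ e) = p e) ∧ (∀ e, p (ψ e) = p' e) ∧
    HomotopicOver p (ψ.comp φ) (ContinuousMap.id E) ∧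
    HomotopicOver p' (φ.comp ψ) (ContinuousMap.id E')

theorem FibEquiv.homotopyEquivOver {p : C(E, X)} {p' : C(E', X)} (h : FibEquiv p p') :
    HomotopyEquivOver p p' := by
  obtain ⟨φ, ψ, hφ, -, h₁, h₂⟩ := h
  exact ⟨φ, isHomotopyEquiv_iff.2 ⟨ψ, h₁.homotopic, h₂.homotopic⟩,
    Homotopic.of_eq (ContinuousMap.ext hφ)⟩

theorem FibEquiv.refl (p : C(E, X)) : FibEquiv p p :=
  ⟨ContinuousMap.id E, ContinuousMap.id E, fun _ => rfl, fun _ => rfl,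
    HomotopicOver.of_eq p rfl, HomotopicOver.of_eq p rfl⟩

open Classical in
/-- A vertical self-map of a fibration that is homotopic to the identity has a right inverse up to
vertical homotopy. -/
theorem IsFib.exists_vertical_right_inverse {p : C(E, X)} (hp : IsFib p) {θ : C(E, E)}
    (hθ : ∀ e, p (θ e) = p e) (h : θ.Homotopic (ContinuousMap.id E)) :
    ∃ θ' : C(E, E), (∀ e, p (θ' e) = p e) ∧
      HomotopicOver p (θ.comp θ') (ContinuousMap.id E) := by
  obtain ⟨G⟩ := h
  obtain ⟨H, hH₀, hH⟩ := hp E (ContinuousMap.id E) (p.comp G.toContinuousMap)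
    (fun z => by simp [hθ])
  have hH' : ∀ y, p (H y) = p (G y) := hH
  let θ' : C(E, E) := ⟨fun e => H (1, e), by fun_prop⟩
  -- `H` runs from the identity to `θ'` over `p ∘ G`. So `K`, which is `θ ∘ H` reversed followed by
  -- `G`, runs from `θ ∘ θ'` to the identity and covers a path traversed backwards and then
  -- forwards.
  let K : C(I × E, E) :=
    { toFun := fun y => if (y.1 : ℝ) ≤ 1 / 2 then θ (H (clampI (1 - 2 * y.1), y.2))
        else G (clampI (2 * y.1 - 1), y.2)
      continuous_toFun := by
        refine Continuous.if_le (by fun_prop) (by fun_prop) (by fun_prop) (by fun_prop) ?_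
        rintro ⟨s, e⟩ h
        dsimp only at h ⊢
        rw [h]; norm_num [hH₀] }
  -- This contracts the backtracking path: the parameter `|1 - 2s|` is raised to at least `u`. On
  -- the edges `s = 0`, `u = 1` and `s = 1` the value is `p e`, so the lift `L` gives vertical
  -- homotopies along these three edges, joining the ends of `K`.
  let W : C(I × I × E, X) :=
    ⟨fun y => p (G (clampI (max |1 - 2 * (y.2.1 : ℝ)| y.1), y.2.2)), by fun_prop⟩
  obtain ⟨L, hL₀, hL⟩ := hp (I × E) K W (by
    rintro ⟨s, e⟩
    simp only [W, K, ContinuousMap.coe_mk]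
    split_ifs with hs
    · rw [hθ, hH', abs_of_nonneg (by linarith), Set.Icc.coe_zero, max_eq_left (by linarith)]
    · rw [abs_of_nonpos (by linarith), Set.Icc.coe_zero, max_eq_left (by linarith), neg_sub])
  have e₀ : ∀ e, K (0, e) = θ (θ' e) := fun e => by norm_num [K, θ']
  have e₁ : ∀ e, K (1, e) = e := fun e => by
    have h₂ : ¬ (1 : ℝ) ≤ 2⁻¹ := by norm_num
    have h₃ : (2 : ℝ) - 1 = 1 := by norm_num
    simp [K, h₂, h₃]
  have w₀ : ∀ u e, p (L (u, 0, e)) = p e := fun u e => by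
    rw [hL]
    simp [W, clampI_of_one_le]
  have w₁ : ∀ u e, p (L (u, 1, e)) = p e := fun u e => by
    rw [hL]
    norm_num [W, clampI_of_one_le]
  have w₂ : ∀ s e, p (L (1, s, e)) = p e := fun s e => by
    rw [hL]
    simp [W, clampI_of_one_le]
  have hθ' : ∀ e, p (θ' e) = p e := fun e => by simp [θ', hH']
  refine ⟨θ', hθ', ?_⟩
  let L₀ : C(E, E) := ⟨fun e => L (1, 0, e), by fun_prop⟩
  let L₁ : C(E, E) := ⟨fun e => L (1, 1, e), by fun_prop⟩
  have c₁ : HomotopicOver p (θ.comp θ') L₀ :=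
    .mk ⟨fun y => L (y.1, 0, y.2), by fun_prop⟩ (fun e => by simp [hL₀, e₀]) (fun e => rfl)
      fun u e => by simp [w₀, hθ, hθ']
  have c₂ : HomotopicOver p L₀ L₁ :=
    .mk ⟨fun y => L (1, y.1, y.2), by fun_prop⟩ (fun e => rfl) (fun e => rfl)
      fun u e => by simp [w₂, L₀]
  have c₃ : HomotopicOver p (ContinuousMap.id E) L₁ :=
    .mk ⟨fun y => L (y.1, 1, y.2), by fun_prop⟩ (fun e => by simp [hL₀, e₁]) (fun e => rfl)
      fun u e => by simp [w₁]
  exact c₁.trans (c₂.trans c₃.symm)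

/-- A map over `X` with values in a fibration may be made strictly compatible with the
projections. -/
theorem IsFib.exists_strict {p : C(E, X)} {p' : C(E', X)} (hp' : IsFib p') {φ : C(E, E')}
    (h : (p'.comp φ).Homotopic p) : ∃ φ' : C(E, E'), φ.Homotopic φ' ∧ ∀ e, p' (φ' e) = p e := by
  obtain ⟨G⟩ := h
  obtain ⟨K, hK₀, hK⟩ := hp' E φ G.toContinuousMap (fun z => by simp)
  refine ⟨⟨fun e => K (1, e), by fun_prop⟩, ⟨⟨K, hK₀, fun e => rfl⟩⟩, fun e => ?_⟩
  exact (hK (1, e)).trans (by simp)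

/-- A homotopy inverse is first made strict over `X`, giving `ψ`. Then `φ ∘ ψ` is a vertical
self-map homotopic to the identity, and precomposing `ψ` with a vertical right inverse of it makes
the remaining homotopy vertical. -/
theorem IsFib.exists_vertical_inverse {p : C(E, X)} {p' : C(E', X)} (hp : IsFib p)
    (hp' : IsFib p') {φ : C(E, E')} (hφ : ∀ e, p' (φ e) = p e) (h : IsHomotopyEquiv φ) :
    ∃ ψ : C(E', E), (∀ e, p (ψ e) = p' e) ∧ IsHomotopyEquiv ψ ∧
      HomotopicOver p' (φ.comp ψ) (ContinuousMap.id E') := by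
  obtain ⟨ψ₀, h₁, h₂⟩ := isHomotopyEquiv_iff.1 h
  have hψ₀ : (p.comp ψ₀).Homotopic p' := by
    have : p.comp ψ₀ = p'.comp (φ.comp ψ₀) := by ext e; simp [hφ]
    rw [this]
    exact Homotopic.comp_left p' h₂
  obtain ⟨ψ, hψψ, hψ⟩ := hp.exists_strict hψ₀
  obtain ⟨θ, hθ, hθ'⟩ := hp'.exists_vertical_right_inverse (θ := φ.comp ψ) (by simp [hφ, hψ])
    ((Homotopic.comp_left φ hψψ.symm).trans h₂)
  refine ⟨ψ.comp θ, by simp [hψ, hθ], ?_, hθ'⟩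
  refine h.of_comp_left ?_
  exact isHomotopyEquiv_id.of_homotopic hθ'.homotopic.symm

/-- Dold's theorem: fibrations that are homotopy equivalent over the base are fibre homotopy
equivalent. -/
theorem IsFib.fibEquiv {p : C(E, X)} {p' : C(E', X)} (hp : IsFib p) (hp' : IsFib p')
    (h : HomotopyEquivOver p p') : FibEquiv p p' := by
  obtain ⟨φ₀, hφ₀, h₀⟩ := h
  obtain ⟨φ, hφφ, hφ⟩ := hp'.exists_strict h₀
  obtain ⟨ψ, hψ, hψe, h₁⟩ := hp.exists_vertical_inverse hp' hφ (hφ₀.of_homotopic hφφ)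
  obtain ⟨χ, hχ, -, h₂⟩ := hp'.exists_vertical_inverse hp hψ hψe
  refine ⟨φ, ψ, hφ, hψ, ?_, h₁⟩
  -- The usual argument that one-sided inverses agree: `φ ≃ φ ∘ ψ ∘ χ ≃ χ`, all vertically.
  have : HomotopicOver p' φ χ :=
    (h₂.symm.comp_left hφ).trans (h₁.comp_right χ)
  exact (this.comp_left hψ).trans h₂

/-- The total space of the fibration that replaces `f`. -/
abbrev PathFib (f : C(A, X)) : Type u := { z : A × C(I, X) // z.2 0 = f z.1 }

/-- The fibration that replaces `f`. -/
def pathFib (f : C(A, X)) : C(PathFib f, X) := ⟨fun z => z.1.2 1, by fun_prop⟩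

theorem PathFib.ext {f : C(A, X)} {z w : PathFib f} (h : z.1.1 = w.1.1)
    (h' : ∀ s, z.1.2 s = w.1.2 s) : z = w :=
  Subtype.ext (Prod.ext h (ContinuousMap.ext h'))

/-- A family of points of `A` and of paths starting at their images gives a map to `PathFib f`. -/
def PathFib.lift {f : C(A, X)} {Z : Type*} [TopologicalSpace Z] (a : C(Z, A)) (w : C(Z × I, X))
    (h : ∀ z, w (z, 0) = f (a z)) : C(Z, PathFib f) where
  toFun z := ⟨(a z, w.curry z), h z⟩
  continuous_toFun := (a.continuous.prodMk w.curry.continuous).subtype_mk h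

/-- The inclusion of the constant paths. -/
def PathFib.const (f : C(A, X)) : C(A, PathFib f) :=
  PathFib.lift (ContinuousMap.id A) ⟨fun y => f y.1, by fun_prop⟩ fun _ => rfl

open Classical in
-- The lift at time `t` prolongs the given path by the track of `H` up to time `t`. The speed `1 +
-- t` leaves the path unchanged at `t = 0` and makes it end at `H (t, z)`.
theorem isFib_pathFib (f : C(A, X)) : IsFib (pathFib f) := by
  intro Z _ g H hH
  let J : C((I × Z) × I, X) :=
    { toFun := fun y => if (y.2 : ℝ) * (1 + y.1.1) ≤ 1 then
          (g y.1.2).1.2 (clampI (y.2 * (1 + y.1.1)))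
        else H (clampI (y.2 * (1 + y.1.1) - 1), y.1.2)
      continuous_toFun := by
        refine Continuous.if_le (by fun_prop) (by fun_prop) (by fun_prop) (by fun_prop) ?_
        rintro ⟨⟨t, z⟩, s⟩ h
        dsimp only at h ⊢
        rw [h]
        simp [hH, pathFib] }
  refine ⟨PathFib.lift ⟨fun y => (g y.2).1.1, by fun_prop⟩ J fun y => ?_, fun z => ?_, ?_⟩
  · simpa [J] using (g y.2).2
  · refine PathFib.ext rfl fun s => ?_
    have : (s : ℝ) ≤ 1 := s.2.2
    simp [PathFib.lift, J, this]
  · rintro ⟨t, z⟩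
    change J ((t, z), 1) = _
    simp only [J, ContinuousMap.coe_mk, Set.Icc.coe_one, one_mul]
    split_ifs with h
    · have : t = 0 := Subtype.ext (le_antisymm (by simpa using h) t.2.1)
      subst this
      simp [hH, pathFib]
    · simp

theorem homotopyEquivOver_pathFib (f : C(A, X)) : HomotopyEquivOver (pathFib f) f := by
  let e : C(PathFib f, A) := ⟨fun z => z.1.1, by fun_prop⟩
  refine ⟨e, isHomotopyEquiv_iff.2 ⟨PathFib.const f, ?_, ContinuousMap.Homotopic.refl _⟩,
    ⟨⟨⟨fun y => y.2.1.2 y.1, by fun_prop⟩, fun z => z.2, fun z => rfl⟩⟩⟩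
  refine ⟨⟨PathFib.lift ⟨fun y : I × PathFib f => y.2.1.1, by fun_prop⟩
    ⟨fun y => y.1.2.1.2 (clampI (y.1.1 * y.2)), by fun_prop⟩ fun y => ?_, fun z => ?_,
    fun z => ?_⟩⟩
  · simpa using y.2.2
  · exact PathFib.ext rfl fun s => by simpa [PathFib.lift, PathFib.const, e] using z.2
  · exact PathFib.ext rfl fun s => by simp [PathFib.lift]

end Fibrations

theorem continuous_of_three_opens {Y Z : Type*} [TopologicalSpace Y] [TopologicalSpace Z]
    {f : Z → Y} {P Q R : Z → Prop} (hP : IsOpen {z | P z}) (hQ : IsOpen {z | Q z})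
    (hR : IsOpen {z | R z}) (h : ∀ z, P z ∨ Q z ∨ R z)
    (fP : Continuous fun z : { z // P z } => f z) (fQ : Continuous fun z : { z // Q z } => f z)
    (fR : Continuous fun z : { z // R z } => f z) : Continuous f := by
  have h₁ : ContinuousOn f {z | P z} := continuousOn_iff_continuous_domRestrict.2 fP
  have h₂ : ContinuousOn f {z | Q z} := continuousOn_iff_continuous_domRestrict.2 fQ
  have h₃ : ContinuousOn f {z | R z} := continuousOn_iff_continuous_domRestrict.2 fR
  refine continuous_iff_continuousAt.2 fun z => ?_
  rcases h z with hz | hz | hz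
  · exact h₁.continuousAt (hP.mem_nhds hz)
  · exact h₂.continuousAt (hQ.mem_nhds hz)
  · exact h₃.continuousAt (hR.mem_nhds hz)

theorem continuous_of_two_opens {Y Z : Type*} [TopologicalSpace Y] [TopologicalSpace Z] {f : Z → Y}
    {P Q : Z → Prop} (hP : IsOpen {z | P z}) (hQ : IsOpen {z | Q z}) (h : ∀ z, P z ∨ Q z)
    (fP : Continuous fun z : { z // P z } => f z) (fQ : Continuous fun z : { z // Q z } => f z) :
    Continuous f :=
  continuous_of_three_opens hP hQ hQ (fun z => (h z).imp_right .inl) fP fQ fQ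

/-! ### The strict fibrewise join -/

section FibJoin

variable {E E' E'' E₁ E₁' X : Type u} [TopologicalSpace E] [TopologicalSpace E']
  [TopologicalSpace E''] [TopologicalSpace E₁] [TopologicalSpace E₁'] [TopologicalSpace X]

/-- The strict fibrewise join of two spaces over `X`. -/
structure FibJoin (p : C(E, X)) (q : C(E', X)) : Type u where
  /-- The join parameter. -/
  t : ℝ
  t_nonneg : 0 ≤ t
  t_le_one : t ≤ 1
  /-- The first component, defined away from the right end of the join. -/
  fst : t < 1 → E
  /-- The second component, defined away from the left end of the join. -/
  snd : 0 < t → E'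
  comm : ∀ h h', p (fst h) = q (snd h')

namespace FibJoin

variable {p : C(E, X)} {q : C(E', X)} {r : C(E'', X)} {p₁ : C(E₁, X)} {q₁ : C(E₁', X)}

/-- The coarsest topology in which the join parameter and the two partially defined components are
continuous on open domains. -/
instance instTopologicalSpace : TopologicalSpace (FibJoin p q) :=
  .induced t inferInstance ⊓
    (.generateFrom {S | ∃ U, IsOpen U ∧ S = {z : FibJoin p q | ∃ h, z.fst h ∈ U}} ⊓
      .generateFrom {S | ∃ U, IsOpen U ∧ S = {z : FibJoin p q | ∃ h, z.snd h ∈ U}})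

theorem ext_of {z w : FibJoin p q} (ht : z.t = w.t) (h₁ : ∀ h h', z.fst h = w.fst h')
    (h₂ : ∀ h h', z.snd h = w.snd h') : z = w := by
  obtain ⟨t, _, _, a, b, _⟩ := z
  obtain ⟨t', _, _, a', b', _⟩ := w
  obtain rfl : t = t' := ht
  obtain rfl : a = a' := funext fun h => h₁ h h
  obtain rfl : b = b' := funext fun h => h₂ h h
  rfl

@[fun_prop]
theorem continuous_t : Continuous (t : FibJoin p q → ℝ) :=
  continuous_iff_le_induced.2 inf_le_left

theorem isOpen_fst {U : Set E} (hU : IsOpen U) : IsOpen {z : FibJoin p q | ∃ h, z.fst h ∈ U} :=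
  (inf_le_right.trans inf_le_left : instTopologicalSpace (p := p) (q := q) ≤ _) _
    (TopologicalSpace.isOpen_generateFrom_of_mem ⟨U, hU, rfl⟩)

theorem isOpen_snd {U : Set E'} (hU : IsOpen U) : IsOpen {z : FibJoin p q | ∃ h, z.snd h ∈ U} :=
  (inf_le_right.trans inf_le_right : instTopologicalSpace (p := p) (q := q) ≤ _) _
    (TopologicalSpace.isOpen_generateFrom_of_mem ⟨U, hU, rfl⟩)

section

variable {Z : Type*} [TopologicalSpace Z] {f : Z → FibJoin p q}

theorem continuous_fst_comp (hf : Continuous f) (h : ∀ z, (f z).t < 1) :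
    Continuous fun z => (f z).fst (h z) := by
  refine continuous_def.2 fun U hU => ?_
  convert (isOpen_fst hU).preimage hf using 1
  ext z
  simp [h]

theorem continuous_snd_comp (hf : Continuous f) (h : ∀ z, 0 < (f z).t) :
    Continuous fun z => (f z).snd (h z) := by
  refine continuous_def.2 fun U hU => ?_
  convert (isOpen_snd hU).preimage hf using 1
  ext z
  simp [h]

/-- This is the benefit of the coarse topology: continuity into the join is tested on the parameter
and on each component over the open set where it is defined. -/
theorem continuous_of (ht : Continuous fun z => (f z).t)
    (h₁ : Continuous fun z : { z // (f z).t < 1 } => (f z.1).fst z.2)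
    (h₂ : Continuous fun z : { z // 0 < (f z).t } => (f z.1).snd z.2) : Continuous f := by
  refine continuous_inf_rng.2 ⟨continuous_induced_rng.2 ht, continuous_inf_rng.2
    ⟨continuous_generateFrom_iff.2 ?_, continuous_generateFrom_iff.2 ?_⟩⟩
  · rintro _ ⟨U, hU, rfl⟩
    convert (isOpen_lt ht continuous_const).isOpenMap_subtype_val _ (hU.preimage h₁) using 1
    ext z
    simp
  · rintro _ ⟨U, hU, rfl⟩
    convert (isOpen_lt continuous_const ht).isOpenMap_subtype_val _ (hU.preimage h₂) using 1
    ext z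
    simp

end

variable (p q) in
open Classical in
/-- The projection of the fibrewise join. -/
noncomputable def proj : C(FibJoin p q, X) where
  toFun z := if h : z.t < 1 then p (z.fst h) else q (z.snd (by linarith))
  continuous_toFun := by
    refine continuous_of_two_opens (P := fun z : FibJoin p q => z.t < 1)
      (Q := fun z : FibJoin p q => 0 < z.t) (isOpen_lt continuous_t continuous_const)
      (isOpen_lt continuous_const continuous_t) (fun z => ?_) ?_ ?_
    · rcases lt_or_ge z.t 1 with h | h
      · exact .inl h
      · exact .inr (by linarith)
    · have : ∀ z : { z : FibJoin p q // z.t < 1 },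
          (if h : z.1.t < 1 then p (z.1.fst h) else q (z.1.snd (by linarith))) =
            p (z.1.fst z.2) := fun z => dif_pos z.2
      simp only [this]
      exact p.continuous.comp (continuous_fst_comp continuous_subtype_val fun z => z.2)
    · have : ∀ z : { z : FibJoin p q // 0 < z.t },
          (if h : z.1.t < 1 then p (z.1.fst h) else q (z.1.snd (by linarith))) =
            q (z.1.snd z.2) := by
        intro z
        split_ifs with h
        · exact z.1.comm h z.2
        · rfl
      simp only [this]
      exact q.continuous.comp (continuous_snd_comp continuous_subtype_val fun z => z.2)

theorem proj_eq_fst (z : FibJoin p q) (h : z.t < 1) : proj p q z = p (z.fst h) := dif_pos h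

theorem proj_eq_snd (z : FibJoin p q) (h : 0 < z.t) : proj p q z = q (z.snd h) := by
  by_cases h' : z.t < 1
  · rw [proj_eq_fst z h', z.comm h' h]
  · exact dif_neg h'

theorem lt_or_pos (z : FibJoin p q) : z.t < 1 ∨ 0 < z.t := by
  rcases lt_or_ge z.t 1 with h | h
  · exact .inl h
  · exact .inr (by linarith)

/-- Two points of joins over `X` have the same projection if they have the same parameter and their
components have the same projections. -/
theorem proj_eq_proj {z : FibJoin p q} {w : FibJoin p₁ q₁} (ht : w.t = z.t)
    (h₁ : ∀ h h', p₁ (w.fst h) = p (z.fst h')) (h₂ : ∀ h h', q₁ (w.snd h) = q (z.snd h')) :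
    proj p₁ q₁ w = proj p q z := by
  rcases z.lt_or_pos with h | h
  · rw [proj_eq_fst z h, proj_eq_fst w (ht ▸ h), h₁]
  · rw [proj_eq_snd z h, proj_eq_snd w (ht ▸ h), h₂]

/-- The fibrewise join of fibrations is a fibration. -/
theorem _root_.Ganea.IsFib.fibJoin (hp : IsFib p) (hq : IsFib q) : IsFib (proj p q) := by
  intro Z _ g H hH
  -- The components are lifted separately over the open sets where they exist, with the join
  -- parameter kept fixed. The lifts are compatible because both cover `H`.
  obtain ⟨K, hK₀, hK⟩ := hp { z // (g z).t < 1 }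
    ⟨fun z => (g z.1).fst z.2, continuous_fst_comp (by fun_prop) _⟩
    ⟨fun y => H (y.1, y.2.1), by fun_prop⟩ (fun z => by simp [hH, proj_eq_fst _ z.2])
  obtain ⟨L, hL₀, hL⟩ := hq { z // 0 < (g z).t }
    ⟨fun z => (g z.1).snd z.2, continuous_snd_comp (by fun_prop) _⟩
    ⟨fun y => H (y.1, y.2.1), by fun_prop⟩ (fun z => by simp [hH, proj_eq_snd _ z.2])
  let M : I × Z → FibJoin p q := fun y =>
    { t := (g y.2).t
      t_nonneg := (g y.2).t_nonneg
      t_le_one := (g y.2).t_le_one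
      fst := fun h => K (y.1, ⟨y.2, h⟩)
      snd := fun h => L (y.1, ⟨y.2, h⟩)
      comm := fun h h' => by rw [hK, hL]; rfl }
  have hM : Continuous M := continuous_of (by simp only [M]; fun_prop)
    (K.continuous.comp (by fun_prop)) (L.continuous.comp (by fun_prop))
  refine ⟨⟨M, hM⟩, fun z => ?_, fun y => ?_⟩
  · exact ext_of rfl (fun h _ => hK₀ ⟨z, h⟩) (fun h _ => hL₀ ⟨z, h⟩)
  · rcases (M y).lt_or_pos with h | h
    · exact (proj_eq_fst _ h).trans (hK _)
    · exact (proj_eq_snd _ h).trans (hL _)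

/-- The fibrewise join of maps over `X`. -/
def map (φ : C(E₁, E)) (ψ : C(E₁', E')) (hφ : ∀ e, p (φ e) = p₁ e) (hψ : ∀ e, q (ψ e) = q₁ e) :
    C(FibJoin p₁ q₁, FibJoin p q) where
  toFun z :=
    { t := z.t
      t_nonneg := z.t_nonneg
      t_le_one := z.t_le_one
      fst := fun h => φ (z.fst h)
      snd := fun h => ψ (z.snd h)
      comm := fun h h' => by rw [hφ, hψ, z.comm] }
  continuous_toFun := continuous_of continuous_t
    (φ.continuous.comp (continuous_fst_comp continuous_subtype_val _))
    (ψ.continuous.comp (continuous_snd_comp continuous_subtype_val _))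

theorem proj_map (φ : C(E₁, E)) (ψ : C(E₁', E')) (hφ : ∀ e, p (φ e) = p₁ e)
    (hψ : ∀ e, q (ψ e) = q₁ e) (z : FibJoin p₁ q₁) :
    proj p q (map φ ψ hφ hψ z) = proj p₁ q₁ z :=
  proj_eq_proj rfl (fun _ _ => hφ _) (fun _ _ => hψ _)

theorem homotopicOver_map {φ φ' : C(E₁, E)} {ψ ψ' : C(E₁', E')} (hφ : ∀ e, p (φ e) = p₁ e)
    (hψ : ∀ e, q (ψ e) = q₁ e) (hφ' : ∀ e, p (φ' e) = p₁ e) (hψ' : ∀ e, q (ψ' e) = q₁ e)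
    (h : HomotopicOver p φ φ') (h' : HomotopicOver q ψ ψ') :
    HomotopicOver (proj p q) (map φ ψ hφ hψ) (map φ' ψ' hφ' hψ') := by
  obtain ⟨K, hK⟩ := h
  obtain ⟨L, hL⟩ := h'
  let M : I × FibJoin p₁ q₁ → FibJoin p q := fun y =>
    { t := y.2.t
      t_nonneg := y.2.t_nonneg
      t_le_one := y.2.t_le_one
      fst := fun h => K (y.1, y.2.fst h)
      snd := fun h => L (y.1, y.2.snd h)
      comm := fun h h' => by rw [hK, hL, hφ, hψ, y.2.comm] }
  have hM : Continuous M := by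
    refine continuous_of (by simp only [M]; fun_prop) (K.continuous.comp ?_) (L.continuous.comp ?_)
    · exact Continuous.prodMk (by fun_prop) (continuous_fst_comp (by fun_prop) _)
    · exact Continuous.prodMk (by fun_prop) (continuous_snd_comp (by fun_prop) _)
  refine .mk ⟨M, hM⟩ (fun z => ?_) (fun z => ?_) fun τ z => ?_
  · exact ext_of rfl (fun h _ => K.apply_zero _) (fun h _ => L.apply_zero _)
  · exact ext_of rfl (fun h _ => K.apply_one _) (fun h _ => L.apply_one _)
  · exact proj_eq_proj rfl (fun _ _ => hK _ _) (fun _ _ => hL _ _)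

theorem _root_.Ganea.FibEquiv.fibJoin (h : FibEquiv p₁ p) (h' : FibEquiv q₁ q) :
    FibEquiv (proj p₁ q₁) (proj p q) := by
  obtain ⟨φ, φ', hφ, hφ', h₁, h₂⟩ := h
  obtain ⟨ψ, ψ', hψ, hψ', h₃, h₄⟩ := h'
  exact ⟨map φ ψ hφ hψ, map φ' ψ' hφ' hψ', proj_map _ _ _ _, proj_map _ _ _ _,
    homotopicOver_map (by simp [hφ, hφ']) (by simp [hψ, hψ']) (fun _ => rfl) (fun _ => rfl) h₁ h₃,
    homotopicOver_map (by simp [hφ, hφ']) (by simp [hψ, hψ']) (fun _ => rfl) (fun _ => rfl) h₂ h₄⟩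

end FibJoin

end FibJoin

/-! ### Symmetry and associativity of the fibrewise join -/

namespace FibJoin

variable {E E' E'' X : Type u} [TopologicalSpace E] [TopologicalSpace E']
  [TopologicalSpace E''] [TopologicalSpace X]

/-- The symmetry of the fibrewise join. -/
def swap (p : C(E, X)) (q : C(E', X)) : C(FibJoin p q, FibJoin q p) where
  toFun z :=
    { t := 1 - z.t
      t_nonneg := by linarith [z.t_le_one]
      t_le_one := by linarith [z.t_nonneg]
      fst := fun h => z.snd (by linarith)
      snd := fun h => z.fst (by linarith)
      comm := fun h h' => (z.comm _ _).symm }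
  continuous_toFun := continuous_of (by fun_prop) (continuous_snd_comp continuous_subtype_val _)
    (continuous_fst_comp continuous_subtype_val _)

section

variable {p : C(E, X)} {q : C(E', X)} {r : C(E'', X)}

theorem swap_swap (z : FibJoin p q) : swap q p (swap p q z) = z :=
  ext_of (by simp [swap]) (fun _ _ => rfl) (fun _ _ => rfl)

theorem proj_swap (z : FibJoin p q) : proj q p (swap p q z) = proj p q z := by
  rcases z.lt_or_pos with h | h
  · have h' : 0 < (swap p q z).t := by simpa [swap] using h
    rw [proj_eq_fst z h, proj_eq_snd _ h']
    rfl
  · have h' : (swap p q z).t < 1 := by simpa [swap] using h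
    rw [proj_eq_snd z h, proj_eq_fst _ h']
    rfl

open Classical in
/-- The outer join parameter of the reassociated point. -/
noncomputable def assocT (z : FibJoin (proj p q) r) : ℝ :=
  -- With inner parameter `t'`, the barycentric weights on `p`, `q`, `r` are `(1 - t)(1 - t')`, `(1
  -- - t)t'` and `t`. The outer parameter after rebracketing is the total weight of `q` and `r`, and
  -- the inner one is the share of `r` in it.
  if h : z.t < 1 then z.t + (1 - z.t) * (z.fst h).t else 1

theorem assocT_of_lt (z : FibJoin (proj p q) r) (h : z.t < 1) :
    assocT z = z.t + (1 - z.t) * (z.fst h).t := dif_pos h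

theorem t_le_assocT (z : FibJoin (proj p q) r) : z.t ≤ assocT z := by
  by_cases h : z.t < 1
  · rw [assocT_of_lt z h]
    nlinarith [(z.fst h).t_nonneg]
  · rw [assocT, dif_neg h]
    exact z.t_le_one

theorem assocT_le_one (z : FibJoin (proj p q) r) : assocT z ≤ 1 := by
  by_cases h : z.t < 1
  · rw [assocT_of_lt z h]
    nlinarith [(z.fst h).t_le_one]
  · rw [assocT, dif_neg h]

/-- At `t = 1` the inner parameter is undefined and need not converge nearby, but the value is
squeezed between `t` and `1`. -/
theorem continuous_assocT : Continuous (assocT : FibJoin (proj p q) r → ℝ) := by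
  refine continuous_iff_continuousAt.2 fun z => ?_
  by_cases h : z.t < 1
  · have : ContinuousOn (assocT : FibJoin (proj p q) r → ℝ) {z | z.t < 1} := by
      refine continuousOn_iff_continuous_domRestrict.2 ?_
      have h' : ∀ z : { z : FibJoin (proj p q) r // z.t < 1 },
          assocT z.1 = z.1.t + (1 - z.1.t) * (z.1.fst z.2).t := fun z => assocT_of_lt z.1 z.2
      have h₁ : Continuous fun z : { z : FibJoin (proj p q) r // z.t < 1 } => z.1.fst z.2 :=
        continuous_fst_comp continuous_subtype_val _
      change Continuous fun z : { z : FibJoin (proj p q) r // z.t < 1 } => assocT z.1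
      simp only [h']
      fun_prop
    exact this.continuousAt ((isOpen_lt continuous_t continuous_const).mem_nhds h)
  · have hz : z.t = 1 := le_antisymm z.t_le_one (not_lt.1 h)
    have hz' : assocT z = 1 := dif_neg h
    refine tendsto_of_tendsto_of_tendsto_of_le_of_le (g := t) (h := fun _ => 1) ?_ ?_
      t_le_assocT assocT_le_one
    · rw [hz', ← hz]
      exact continuous_t.continuousAt
    · rw [hz']
      exact tendsto_const_nhds

theorem lt_of_assocT_lt {z : FibJoin (proj p q) r} (h : assocT z < 1) : z.t < 1 :=
  (t_le_assocT z).trans_lt h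

theorem fst_lt_of_assocT_lt {z : FibJoin (proj p q) r} (h : assocT z < 1) :
    (z.fst (lt_of_assocT_lt h)).t < 1 := by
  have h₁ := lt_of_assocT_lt h
  rw [assocT_of_lt z h₁] at h
  by_contra h'
  nlinarith

theorem lt_of_div_lt {z : FibJoin (proj p q) r} (h : 0 < assocT z) (h' : z.t / assocT z < 1) :
    z.t < 1 := by
  rw [div_lt_one h] at h'
  exact h'.trans_le (assocT_le_one z)

theorem fst_pos_of_div_lt {z : FibJoin (proj p q) r} (h : 0 < assocT z)
    (h' : z.t / assocT z < 1) : 0 < (z.fst (lt_of_div_lt h h')).t := by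
  have h₁ := lt_of_div_lt h h'
  rw [div_lt_one h, assocT_of_lt z h₁] at h'
  by_contra h''
  nlinarith

theorem pos_of_div_pos {z : FibJoin (proj p q) r} (h : 0 < assocT z) (h' : 0 < z.t / assocT z) :
    0 < z.t := by
  by_contra h''
  exact absurd h' (not_lt.2 (div_nonpos_of_nonpos_of_nonneg (not_lt.1 h'') h.le))

/-- The inner point of the reassociated point. -/
noncomputable def assocSnd (z : FibJoin (proj p q) r) (h : 0 < assocT z) : FibJoin q r where
  t := z.t / assocT z
  t_nonneg := div_nonneg z.t_nonneg h.le
  t_le_one := (div_le_one h).2 (t_le_assocT z)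
  fst h' := (z.fst (lt_of_div_lt h h')).snd (fst_pos_of_div_lt h h')
  snd h' := z.snd (pos_of_div_pos h h')
  comm h' h'' := by rw [← proj_eq_snd, z.comm]

theorem proj_assocSnd (z : FibJoin (proj p q) r) (h : 0 < assocT z) :
    proj q r (assocSnd z h) = proj (proj p q) r z := by
  rcases (assocSnd z h).lt_or_pos with h' | h'
  · rw [proj_eq_fst _ h', proj_eq_fst z (lt_of_div_lt h h'),
      proj_eq_snd _ (fst_pos_of_div_lt h h')]
    rfl
  · rw [proj_eq_snd _ h', proj_eq_snd z (pos_of_div_pos h h')]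
    rfl

theorem continuous_assocSnd :
    Continuous fun z : { z : FibJoin (proj p q) r // 0 < assocT z } => assocSnd z.1 z.2 := by
  refine continuous_of ?_ ?_ ?_
  · exact (continuous_t.comp continuous_subtype_val).div
      (continuous_assocT.comp continuous_subtype_val) fun z => z.2.ne'
  · exact continuous_snd_comp (continuous_fst_comp
      (continuous_subtype_val.comp continuous_subtype_val) _) _
  · exact continuous_snd_comp (continuous_subtype_val.comp continuous_subtype_val) _

variable (p q r) in
/-- The associativity map of the fibrewise join. -/
noncomputable def assoc : C(FibJoin (proj p q) r, FibJoin p (proj q r)) where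
  toFun z :=
    { t := assocT z
      t_nonneg := z.t_nonneg.trans (t_le_assocT z)
      t_le_one := assocT_le_one z
      fst := fun h => (z.fst (lt_of_assocT_lt h)).fst (fst_lt_of_assocT_lt h)
      snd := fun h => assocSnd z h
      comm := fun h h' => by rw [proj_assocSnd, ← proj_eq_fst, ← proj_eq_fst] }
  continuous_toFun := continuous_of continuous_assocT
    (continuous_fst_comp (continuous_fst_comp continuous_subtype_val _) _)
    continuous_assocSnd

theorem proj_assoc (z : FibJoin (proj p q) r) :
    proj p (proj q r) (assoc p q r z) = proj (proj p q) r z := by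
  rcases (assoc p q r z).lt_or_pos with h | h
  · rw [proj_eq_fst _ h, proj_eq_fst z (lt_of_assocT_lt h), proj_eq_fst _ (fst_lt_of_assocT_lt h)]
    rfl
  · rw [proj_eq_snd _ h]
    exact proj_assocSnd z h

end

/-- The reversal of a twofold join, from the right-associated to the left-associated form. -/
noncomputable def rev (p : C(E, X)) (q : C(E', X)) (r : C(E'', X)) :
    C(FibJoin p (proj q r), FibJoin (proj r q) p) :=
  (map (swap q r) (ContinuousMap.id E) proj_swap fun _ => rfl).comp (swap p (proj q r))

theorem proj_rev (p : C(E, X)) (q : C(E', X)) (r : C(E'', X)) (z : FibJoin p (proj q r)) :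
    proj (proj r q) p (rev p q r z) = proj p (proj q r) z :=
  (proj_map _ _ proj_swap (fun _ => rfl) _).trans (proj_swap z)

/-- The reversal of a twofold join, from the left-associated to the right-associated form. -/
noncomputable def rev' (p : C(E, X)) (q : C(E', X)) (r : C(E'', X)) :
    C(FibJoin (proj r q) p, FibJoin p (proj q r)) :=
  (swap (proj q r) p).comp (map (swap r q) (ContinuousMap.id E) proj_swap fun _ => rfl)

theorem rev'_rev (p : C(E, X)) (q : C(E', X)) (r : C(E'', X)) (z : FibJoin p (proj q r)) :
    rev' p q r (rev p q r z) = z :=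
  ext_of (by simp [rev, rev', swap, map]) (fun _ _ => rfl) (fun _ _ => swap_swap _)

theorem rev_rev' (p : C(E, X)) (q : C(E', X)) (r : C(E'', X)) (z : FibJoin (proj r q) p) :
    rev p q r (rev' p q r z) = z :=
  ext_of (by simp [rev, rev', swap, map]) (fun _ _ => swap_swap _) (fun _ _ => rfl)

/-- Rebracketing preserves barycentric weights, and reversal only permutes them. Hence conjugating
`assoc` by reversals inverts it, and the inverse needs no continuity proof of its own. -/
theorem assoc_rev_assoc (p : C(E, X)) (q : C(E', X)) (r : C(E'', X))
    (z : FibJoin (proj p q) r) :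
    assoc r q p (rev p q r (assoc p q r z)) = rev' r q p z := by
  have ht : (rev p q r (assoc p q r z)).t = 1 - assocT z := rfl
  have hT : assocT (rev p q r (assoc p q r z)) = 1 - z.t := by
    by_cases h : 0 < assocT z
    · rw [assocT_of_lt _ (by rw [ht]; linarith)]
      change 1 - assocT z + (1 - (1 - assocT z)) * (1 - z.t / assocT z) = 1 - z.t
      field_simp
      ring
    -- All weight is on `p`; after reversal the outer parameter is `1`, where `assocT` takes its
    -- default value `1`, as required.
    · have h₀ : assocT z = 0 := le_antisymm (not_lt.1 h) (z.t_nonneg.trans (t_le_assocT z))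
      have h₁ : z.t = 0 := le_antisymm (h₀ ▸ t_le_assocT z) z.t_nonneg
      rw [assocT, dif_neg (by rw [ht, h₀]; norm_num), h₁, sub_zero]
  refine ext_of hT (fun _ _ => rfl) fun h h' => ext_of ?_ (fun _ _ => rfl) (fun _ _ => rfl)
  have h₀ : z.t < 1 := by
    change 0 < 1 - z.t at h'
    linarith
  change (1 - assocT z) / assocT (rev p q r (assoc p q r z)) = 1 - (z.fst h₀).t
  rw [hT, assocT_of_lt z h₀, div_eq_iff (by linarith)]
  ring

/-- Associativity of the fibrewise join. -/
theorem fibEquiv_assoc (p : C(E, X)) (q : C(E', X)) (r : C(E'', X)) :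
    FibEquiv (proj (proj p q) r) (proj p (proj q r)) := by
  let β : C(FibJoin p (proj q r), FibJoin (proj p q) r) :=
    (rev r q p).comp ((assoc r q p).comp (rev p q r))
  have h₁ : ∀ z, β (assoc p q r z) = z := fun z => by
    simp only [β, ContinuousMap.comp_apply, assoc_rev_assoc, rev_rev']
  have h₂ : ∀ z, assoc p q r (β z) = z := fun z => by
    have := assoc_rev_assoc r q p (rev p q r z)
    simp only [β, ContinuousMap.comp_apply]
    rw [this, rev'_rev]
  exact ⟨assoc p q r, β, proj_assoc, fun z => by
    simp only [β, ContinuousMap.comp_apply, proj_rev, proj_assoc],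
    .of_eq _ (ContinuousMap.ext h₁), .of_eq _ (ContinuousMap.ext h₂)⟩

end FibJoin

/-! ### Comparison of the strict join with the double mapping cylinder -/

section Comparison

variable {A B X : Type u} [TopologicalSpace A] [TopologicalSpace B] [TopologicalSpace X]
  (f : C(A, X)) (g : C(B, X))

namespace StdPullback

/-- The first projection of the standard homotopy pullback. -/
def fst : C(StdPullback f g, A) := ⟨fun z => z.1.1, by fun_prop⟩

/-- The second projection of the standard homotopy pullback. -/
def snd : C(StdPullback f g, B) := ⟨fun z => z.1.2.1, by fun_prop⟩

variable {f g}

theorem ext {z w : StdPullback f g} (h : z.1.1 = w.1.1) (h' : z.1.2.1 = w.1.2.1)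
    (h'' : ∀ s, z.1.2.2 s = w.1.2.2 s) : z = w :=
  Subtype.ext (Prod.ext h (Prod.ext h' (ContinuousMap.ext h'')))

/-- A family of pairs of points and of connecting paths gives a map to the standard homotopy
pullback. -/
def lift {Z : Type*} [TopologicalSpace Z] (a : C(Z, A)) (b : C(Z, B)) (w : C(Z × I, X))
    (h₀ : ∀ z, w (z, 0) = f (a z)) (h₁ : ∀ z, w (z, 1) = g (b z)) : C(Z, StdPullback f g) where
  toFun z := ⟨(a z, b z, w.curry z), h₀ z, h₁ z⟩
  continuous_toFun := (a.continuous.prodMk (b.continuous.prodMk w.curry.continuous)).subtype_mk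
    fun z => ⟨h₀ z, h₁ z⟩

end StdPullback

namespace FibJoin

variable {f g}

open Classical in
/-- The path obtained from the two path components of a point of the join of `pathFib f` and
`pathFib g`, as far as they are defined. -/
noncomputable def path (z : FibJoin (pathFib f) (pathFib g)) (s : ℝ) : X :=
  if s ≤ 1 / 2 then
    if h : z.t < 1 then (z.fst h).1.2 (clampI (2 * s)) else proj _ _ z
  else
    if h : 0 < z.t then (z.snd h).1.2 (clampI (2 - 2 * s)) else proj _ _ z

theorem path_of_le {z : FibJoin (pathFib f) (pathFib g)} (h : z.t < 1) {s : ℝ} (hs : s ≤ 1 / 2) :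
    path z s = (z.fst h).1.2 (clampI (2 * s)) := by
  rw [path, if_pos hs, dif_pos h]

theorem path_of_ge {z : FibJoin (pathFib f) (pathFib g)} (h : 0 < z.t) {s : ℝ} (hs : 1 / 2 ≤ s) :
    path z s = (z.snd h).1.2 (clampI (2 - 2 * s)) := by
  rcases hs.eq_or_lt with rfl | hs
  · have h' : (z.snd h).1.2 (clampI (2 - 2 * (1 / 2))) = proj _ _ z := by
      rw [proj_eq_snd z h]
      norm_num [pathFib]
    rw [h', path, if_pos le_rfl]
    split_ifs with h''
    · rw [proj_eq_fst z h'']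
      norm_num [pathFib]
    · rfl
  · rw [path, if_neg (not_le.2 hs), dif_pos h]

theorem path_zero {z : FibJoin (pathFib f) (pathFib g)} (h : z.t < 1) :
    path z 0 = f (z.fst h).1.1 := by
  rw [path_of_le h (by norm_num)]
  simpa using (z.fst h).2

theorem path_one {z : FibJoin (pathFib f) (pathFib g)} (h : 0 < z.t) :
    path z 1 = g (z.snd h).1.1 := by
  rw [path_of_ge h (by norm_num)]
  simpa using (z.snd h).2

section

variable {Y : Type*} [TopologicalSpace Y] {z : Y → FibJoin (pathFib f) (pathFib g)} {s : Y → ℝ}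

theorem continuous_path_of_le (hz : Continuous z) (hs : Continuous s) (h : ∀ y, (z y).t < 1)
    (h' : ∀ y, s y ≤ 1 / 2) : Continuous fun y => path (z y) (s y) := by
  have e : ∀ y, path (z y) (s y) = ((z y).fst (h y)).1.2 (clampI (2 * s y)) :=
    fun y => path_of_le (h y) (h' y)
  have := continuous_fst_comp hz h
  simp only [e]
  fun_prop

theorem continuous_path_of_ge (hz : Continuous z) (hs : Continuous s) (h : ∀ y, 0 < (z y).t)
    (h' : ∀ y, 1 / 2 ≤ s y) : Continuous fun y => path (z y) (s y) := by
  have e : ∀ y, path (z y) (s y) = ((z y).snd (h y)).1.2 (clampI (2 - 2 * s y)) :=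
    fun y => path_of_ge (h y) (h' y)
  have := continuous_snd_comp hz h
  simp only [e]
  fun_prop

open Classical in
theorem continuous_path_of_mem (hz : Continuous z) (hs : Continuous s)
    (h : ∀ y, 0 < (z y).t ∧ (z y).t < 1) : Continuous fun y => path (z y) (s y) := by
  have e : ∀ y, path (z y) (s y) = if s y ≤ 1 / 2 then
      ((z y).fst (h y).2).1.2 (clampI (2 * s y))
      else ((z y).snd (h y).1).1.2 (clampI (2 - 2 * s y)) := by
    intro y
    split_ifs with hs
    · exact path_of_le (h y).2 hs
    · exact path_of_ge (h y).1 (not_le.1 hs).le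
  have h₁ := continuous_fst_comp hz fun y => (h y).2
  have h₂ := continuous_snd_comp hz fun y => (h y).1
  simp only [e]
  refine Continuous.if_le (by fun_prop) (by fun_prop) hs continuous_const fun y hy => ?_
  rw [← path_of_le _ hy.le, ← path_of_ge _ hy.ge]

/-- Near `t = 0` the second component is lost, so only the first half of the concatenated path is
controlled there; the hypothesis `h'` keeps `s` in that half. -/
theorem continuous_path_of_lt_one (hz : Continuous z) (hs : Continuous s) (h : ∀ y, (z y).t < 1)
    (h' : ∀ y, (z y).t < 1 / 3 → s y ≤ 1 / 2) : Continuous fun y => path (z y) (s y) := by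
  refine continuous_of_two_opens (P := fun y => (z y).t < 1 / 3) (Q := fun y => 0 < (z y).t)
    (isOpen_lt (by fun_prop) continuous_const) (isOpen_lt continuous_const (by fun_prop))
    (fun y => ?_) ?_ ?_
  · by_cases h₁ : (z y).t < 1 / 3
    · exact .inl h₁
    · exact .inr (by linarith)
  · exact continuous_path_of_le (by fun_prop) (by fun_prop) (fun y => h y) fun y => h' y y.2
  · exact continuous_path_of_mem (by fun_prop) (by fun_prop) fun y => ⟨y.2, h y⟩

theorem continuous_path_of_pos (hz : Continuous z) (hs : Continuous s) (h : ∀ y, 0 < (z y).t)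
    (h' : ∀ y, 2 / 3 < (z y).t → 1 / 2 ≤ s y) : Continuous fun y => path (z y) (s y) := by
  refine continuous_of_two_opens (P := fun y => 2 / 3 < (z y).t) (Q := fun y => (z y).t < 1)
    (isOpen_lt continuous_const (by fun_prop)) (isOpen_lt (by fun_prop) continuous_const)
    (fun y => ?_) ?_ ?_
  · by_cases h₁ : 2 / 3 < (z y).t
    · exact .inl h₁
    · exact .inr (by linarith)
  · exact continuous_path_of_ge (by fun_prop) (by fun_prop) (fun y => h y) fun y => h' y y.2
  · exact continuous_path_of_mem (by fun_prop) (by fun_prop) fun y => ⟨h y, y.2⟩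

end

/-- The point of the homotopy pullback under an interior point of the join. -/
noncomputable def toPullback :
    C({ z : FibJoin (pathFib f) (pathFib g) // 0 < z.t ∧ z.t < 1 }, StdPullback f g) :=
  StdPullback.lift
    ⟨fun z => (z.1.fst z.2.2).1.1, (continuous_fst.comp continuous_subtype_val).comp
      (continuous_fst_comp continuous_subtype_val _)⟩
    ⟨fun z => (z.1.snd z.2.1).1.1, (continuous_fst.comp continuous_subtype_val).comp
      (continuous_snd_comp continuous_subtype_val _)⟩
    ⟨fun y => path y.1.1 y.2, continuous_path_of_mem (by fun_prop) (by fun_prop) fun y => y.1.2⟩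
    (fun z => path_zero z.2.2) (fun z => path_one z.2.1)

open Classical in
/-- The underlying function of `FibJoin.toPushout`. -/
noncomputable def toPushoutFun (z : FibJoin (pathFib f) (pathFib g)) :
    StdPushout (StdPullback.fst f g) (StdPullback.snd f g) :=
  -- The cylinder coordinate is constant on the outer thirds, so near each end the map depends only
  -- on the component that survives there.
  if h : 0 < z.t ∧ z.t < 1 then StdPushout.mid _ _ (toPullback ⟨z, h⟩, clampI (3 * z.t - 1))
  else if h : z.t < 1 then StdPushout.inl _ _ (z.fst h).1.1
  else StdPushout.inr _ _ (z.snd (by linarith)).1.1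

theorem toPushoutFun_of_mem (z : FibJoin (pathFib f) (pathFib g)) (h : 0 < z.t ∧ z.t < 1) :
    toPushoutFun z = StdPushout.mid _ _ (toPullback ⟨z, h⟩, clampI (3 * z.t - 1)) := dif_pos h

theorem toPushoutFun_of_le (z : FibJoin (pathFib f) (pathFib g)) (h : z.t ≤ 1 / 3) :
    toPushoutFun z = StdPushout.inl _ _ (z.fst (by linarith)).1.1 := by
  by_cases h' : 0 < z.t ∧ z.t < 1
  · rw [toPushoutFun_of_mem z h', clampI_of_nonpos (by linarith), StdPushout.mid_zero]
    rfl
  · rw [toPushoutFun, dif_neg h', dif_pos]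

theorem toPushoutFun_of_ge (z : FibJoin (pathFib f) (pathFib g)) (h : 2 / 3 ≤ z.t) :
    toPushoutFun z = StdPushout.inr _ _ (z.snd (by linarith)).1.1 := by
  by_cases h' : 0 < z.t ∧ z.t < 1
  · rw [toPushoutFun_of_mem z h', clampI_of_one_le (by linarith), StdPushout.mid_one]
    rfl
  · rw [toPushoutFun, dif_neg h', dif_neg fun h'' => h' ⟨by linarith, h''⟩]

variable (f g) in
/-- The map from the fibrewise join of the path fibrations to the double mapping cylinder. -/
noncomputable def toPushout : C(FibJoin (pathFib f) (pathFib g),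
    StdPushout (StdPullback.fst f g) (StdPullback.snd f g)) where
  toFun := toPushoutFun
  continuous_toFun := by
    refine continuous_of_three_opens (P := fun z => z.t < 1 / 3) (Q := fun z => 2 / 3 < z.t)
      (R := fun z => 0 < z.t ∧ z.t < 1) (isOpen_lt (by fun_prop) continuous_const)
      (isOpen_lt continuous_const (by fun_prop)) ((isOpen_lt continuous_const
        (by fun_prop)).and (isOpen_lt (by fun_prop) continuous_const)) (fun z => ?_) ?_ ?_ ?_
    · by_cases h₁ : z.t < 1 / 3
      · exact .inl h₁
      by_cases h₂ : 2 / 3 < z.t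
      · exact .inr (.inl h₂)
      · exact .inr (.inr ⟨by linarith, by linarith⟩)
    · simp only [fun z : { z : FibJoin (pathFib f) (pathFib g) // z.t < 1 / 3 } =>
        toPushoutFun_of_le z.1 z.2.le]
      exact (StdPushout.inl _ _).continuous.comp ((continuous_fst.comp continuous_subtype_val).comp
        (continuous_fst_comp continuous_subtype_val _))
    · simp only [fun z : { z : FibJoin (pathFib f) (pathFib g) // 2 / 3 < z.t } =>
        toPushoutFun_of_ge z.1 z.2.le]
      exact (StdPushout.inr _ _).continuous.comp ((continuous_fst.comp continuous_subtype_val).comp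
        (continuous_snd_comp continuous_subtype_val _))
    · simp only [fun z : { z : FibJoin (pathFib f) (pathFib g) // 0 < z.t ∧ z.t < 1 } =>
        toPushoutFun_of_mem z.1 z.2]
      exact (StdPushout.mid _ _).continuous.comp
        (toPullback.continuous.prodMk (by fun_prop))

/-- The restriction of `FibJoin.ofPushout` to the cylinder. -/
noncomputable def ofPushoutMid :
    C(StdPullback f g × I, FibJoin (pathFib f) (pathFib g)) :=
  -- The path is cut at time `t`: `l` is its initial piece and `r` its final piece reversed, both
  -- ending at the cutting point.
  let l : C(StdPullback f g × I, PathFib f) := PathFib.lift ⟨fun y => y.1.1.1, by fun_prop⟩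
    ⟨fun y => y.1.1.1.2.2 (clampI (y.1.2 * y.2)), by fun_prop⟩ fun y => by simpa using y.1.2.1
  let r : C(StdPullback f g × I, PathFib g) := PathFib.lift ⟨fun y => y.1.1.2.1, by fun_prop⟩
    ⟨fun y => y.1.1.1.2.2 (clampI (1 - (1 - y.1.2) * y.2)), by fun_prop⟩
    fun y => by simpa using y.1.2.2
  { toFun := fun y =>
      { t := y.2
        t_nonneg := y.2.2.1
        t_le_one := y.2.2.2
        fst := fun _ => l y
        snd := fun _ => r y
        comm := fun _ _ => by simp [l, r, pathFib, PathFib.lift] }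
    continuous_toFun := continuous_of (by fun_prop) (by fun_prop) (by fun_prop) }

variable (f g) in
/-- The map from the double mapping cylinder to the fibrewise join of the path fibrations. -/
noncomputable def ofPushout : C(StdPushout (StdPullback.fst f g) (StdPullback.snd f g),
    FibJoin (pathFib f) (pathFib g)) :=
  StdPushout.desc
    { toFun := fun a =>
        { t := 0
          t_nonneg := le_rfl
          t_le_one := zero_le_one
          fst := fun _ => PathFib.const f a
          snd := fun h => (lt_irrefl _ h).elim
          comm := fun _ h => (lt_irrefl _ h).elim }
      continuous_toFun := continuous_of continuous_const (by fun_prop)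
        (continuous_iff_continuousAt.2 fun z => (lt_irrefl _ z.2).elim) }
    ofPushoutMid
    { toFun := fun b =>
        { t := 1
          t_nonneg := zero_le_one
          t_le_one := le_rfl
          fst := fun h => (lt_irrefl _ h).elim
          snd := fun _ => PathFib.const g b
          comm := fun h _ => (lt_irrefl _ h).elim }
      continuous_toFun := continuous_of continuous_const
        (continuous_iff_continuousAt.2 fun z => (lt_irrefl _ z.2).elim) (by fun_prop) }
    (fun x => ext_of rfl
      (fun _ _ => PathFib.ext rfl fun s => by
        simpa [ofPushoutMid, PathFib.lift, PathFib.const, StdPullback.fst] using x.2.1)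
      fun _ h => (lt_irrefl _ h).elim)
    (fun x => ext_of rfl (fun _ h => (lt_irrefl _ h).elim)
      fun _ _ => PathFib.ext rfl fun s => by
        simpa [ofPushoutMid, PathFib.lift, PathFib.const, StdPullback.snd] using x.2.2)

theorem proj_ofPushout (z : StdPushout (StdPullback.fst f g) (StdPullback.snd f g)) :
    proj _ _ (ofPushout f g z) = fromStdPushout (stdPullbackHomotopy f g) z := by
  induction z using StdPushout.ind with
  | hl a => exact proj_eq_fst _ zero_lt_one
  | hm x t =>
    rcases (ofPushout f g (StdPushout.mid _ _ (x, t))).lt_or_pos with h | h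
    · rw [proj_eq_fst _ h]
      change x.1.2.2 (clampI (t * (1 : I))) = x.1.2.2 t
      simp
    · rw [proj_eq_snd _ h]
      change x.1.2.2 (clampI (1 - (1 - t) * (1 : I))) = x.1.2.2 t
      simp
  | hr b => exact proj_eq_snd _ zero_lt_one

end FibJoin

end Comparison

section Comparison

variable {A B X : Type u} [TopologicalSpace A] [TopologicalSpace B] [TopologicalSpace X]
  (f : C(A, X)) (g : C(B, X))

namespace FibJoin

/-- Cutting a path at time `t` and gluing the pieces at time `1 / 2` only reparametrises it. The
function `ρ` interpolates linearly from this reparametrisation to the identity, while the cylinder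
coordinate moves from `clampI (3 * t - 1)` to `t`. -/
theorem toPushout_comp_ofPushout :
    ((toPushout f g).comp (ofPushout f g)).Homotopic (ContinuousMap.id _) := by
  let ρ : I → I → I → ℝ := fun τ t s => (1 - τ) *
    (min (2 * (s : ℝ)) 1 * t + max (2 * (s : ℝ) - 1) 0 * (1 - t)) + τ * s
  let w : C(I × StdPullback f g × I, StdPullback f g) := StdPullback.lift
    ⟨fun y => y.2.1.1.1, by fun_prop⟩ ⟨fun y => y.2.1.1.2.1, by fun_prop⟩
    ⟨fun y => y.1.2.1.1.2.2 (clampI (ρ y.1.1 y.1.2.2 y.2)), by fun_prop⟩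
    (fun y => by simpa [ρ] using y.2.1.2.1)
    (fun y => by
      have h : (2 : ℝ) - 1 = 1 := by norm_num
      simpa [ρ, h] using y.2.1.2.2)
  let m : C(I × StdPullback f g × I, StdPushout (StdPullback.fst f g) (StdPullback.snd f g)) :=
    ⟨fun y => StdPushout.mid _ _ (w y, clampI ((1 - y.1) * clampI (3 * y.2.2 - 1) + y.1 * y.2.2)),
      by fun_prop⟩
  have e₀ : ∀ a, toPushout f g (ofPushout f g (StdPushout.inl _ _ a)) = StdPushout.inl _ _ a :=
    fun a => toPushoutFun_of_le _ (show (0 : ℝ) ≤ 1 / 3 by norm_num)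
  have e₁ : ∀ b, toPushout f g (ofPushout f g (StdPushout.inr _ _ b)) = StdPushout.inr _ _ b :=
    fun b => toPushoutFun_of_ge _ (show 2 / 3 ≤ (1 : ℝ) by norm_num)
  have m₀ : ∀ τ x, m (τ, x, 0) = StdPushout.inl _ _ x.1.1 := by
    intro τ x
    have : clampI (-1) = 0 := clampI_of_nonpos (by norm_num)
    simp only [m, ContinuousMap.coe_mk, Set.Icc.coe_zero, mul_zero, zero_sub, this, add_zero,
      clampI_zero, StdPushout.mid_zero]
    rfl
  have m₁ : ∀ τ x, m (τ, x, 1) = StdPushout.inr _ _ x.1.2.1 := by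
    intro τ x
    have : clampI (3 - 1) = 1 := clampI_of_one_le (by norm_num)
    simp only [m, ContinuousMap.coe_mk, Set.Icc.coe_one, mul_one, this, sub_add_cancel,
      clampI_one, StdPushout.mid_one]
    rfl
  refine StdPushout.homotopic_of_rel_ends m e₀ e₁ (fun τ x => ?_) (fun τ x => ?_) (fun x t => ?_)
    (fun x t => ?_)
  · rw [m₀, ContinuousMap.comp_apply, e₀]
    rfl
  · rw [m₁, ContinuousMap.comp_apply, e₁]
    rfl
  · by_cases h₀ : t = 0
    · subst h₀
      rw [m₀, StdPushout.mid_zero, ContinuousMap.comp_apply, e₀]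
      rfl
    by_cases h₁ : t = 1
    · subst h₁
      rw [m₁, StdPushout.mid_one, ContinuousMap.comp_apply, e₁]
      rfl
    have h : 0 < (ofPushout f g (StdPushout.mid _ _ (x, t))).t ∧
        (ofPushout f g (StdPushout.mid _ _ (x, t))).t < 1 :=
      ⟨unitInterval.pos_iff_ne_zero.2 h₀, unitInterval.lt_one_iff_ne_one.2 h₁⟩
    refine Eq.trans ?_ (toPushoutFun_of_mem _ h).symm
    change StdPushout.mid _ _ (w (0, x, t),
      clampI ((1 - (0 : I)) * clampI (3 * (t : ℝ) - 1) + (0 : I) * t)) = _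
    have hc : clampI ((1 - ((0 : I) : ℝ)) * clampI (3 * (t : ℝ) - 1) + (0 : I) * (t : ℝ)) =
        clampI (3 * (t : ℝ) - 1) := by simp
    rw [hc]
    refine congrArg (fun y => StdPushout.mid _ _ (y, clampI (3 * (t : ℝ) - 1))) ?_
    refine StdPullback.ext rfl rfl fun s => ?_
    change x.1.2.2 (clampI (ρ 0 t s)) = path _ s
    rcases le_total (s : ℝ) (1 / 2) with hs | hs
    · rw [path_of_le h.2 hs]
      change _ = x.1.2.2 (clampI (t * clampI (2 * (s : ℝ))))
      rw [coe_clampI, min_eq_right (by linarith), max_eq_right (by linarith [s.2.1])]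
      simp only [ρ, Set.Icc.coe_zero]
      rw [min_eq_left (by linarith), max_eq_right (by linarith)]
      congr 2
      ring
    · rw [path_of_ge h.1 hs]
      change _ = x.1.2.2 (clampI (1 - (1 - t) * clampI (2 - 2 * (s : ℝ))))
      rw [coe_clampI, min_eq_right (by linarith), max_eq_right (by linarith [s.2.2])]
      simp only [ρ, Set.Icc.coe_zero]
      rw [min_eq_right (by linarith), max_eq_left (by linarith)]
      congr 2
      ring
  · have hw : w (1, x, t) = x := by
      refine StdPullback.ext rfl rfl fun s => ?_
      change x.1.2.2 (clampI (ρ 1 t s)) = _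
      simp [ρ]
    change StdPushout.mid _ _ (w (1, x, t), _) = StdPushout.mid _ _ (x, t)
    rw [hw]
    simp

end FibJoin

end Comparison

section Comparison

variable {A B X : Type u} [TopologicalSpace A] [TopologicalSpace B] [TopologicalSpace X]
  (f : C(A, X)) (g : C(B, X))

namespace FibJoin

/-- The composite cuts the concatenated path at time `c t`, whereas the original pair of paths is
recovered by cutting at `1 / 2`. The homotopy moves the cutting time `R` between these values and
the join parameter `T` from `c t` to `t`. -/
theorem ofPushout_comp_toPushout :
    ((ofPushout f g).comp (toPushout f g)).Homotopic (ContinuousMap.id _) := by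
  let c : ℝ → ℝ := fun t => clampI (3 * t - 1)
  have c_le : ∀ {t}, t ≤ 1 / 3 → c t = 0 := fun h => by
    simp [c, clampI_of_nonpos (show 3 * _ - 1 ≤ (0 : ℝ) by linarith)]
  have c_ge : ∀ {t}, 2 / 3 ≤ t → c t = 1 := fun h => by
    simp [c, clampI_of_one_le (show (1 : ℝ) ≤ 3 * _ - 1 by linarith)]
  have c_nonneg : ∀ t, 0 ≤ c t := fun t => (clampI _).2.1
  have c_le_one : ∀ t, c t ≤ 1 := fun t => (clampI _).2.2
  have hc : Continuous c := by fun_prop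
  -- Since `c` fixes `0` and `1`, a component of the new point is required only where the old point
  -- has it. Since `c` is constant on the outer thirds, `R ≤ 1 / 2` near `t = 0` and `R ≥ 1 / 2`
  -- near `t = 1`, which confines the pieces near each end to the half of the path that varies
  -- continuously.
  let T : I × FibJoin (pathFib f) (pathFib g) → ℝ := fun y => (1 - y.1) * c y.2.t + y.1 * y.2.t
  let R : I × FibJoin (pathFib f) (pathFib g) → ℝ := fun y => (1 - y.1) * c y.2.t + y.1 * (1 / 2)
  have hT : Continuous T := by fun_prop
  have hR : Continuous R := by fun_prop
  have lt_one : ∀ y, T y < 1 → y.2.t < 1 := by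
    intro y h
    refine lt_of_le_of_ne y.2.t_le_one fun h' => ?_
    simp only [T, h'] at h
    rw [c_ge (by norm_num)] at h
    linarith
  have pos : ∀ y, 0 < T y → 0 < y.2.t := by
    intro y h
    refine lt_of_le_of_ne y.2.t_nonneg fun h' => ?_
    simp only [T, ← h'] at h
    rw [c_le (by norm_num)] at h
    linarith
  have R_le : ∀ y, y.2.t < 1 / 3 → R y ≤ 1 / 2 := by
    intro y h
    simp only [R, c_le h.le]
    linarith [y.1.2.2]
  have R_ge : ∀ y, 2 / 3 < y.2.t → 1 / 2 ≤ R y := by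
    intro y h
    simp only [R, c_ge h.le]
    linarith [y.1.2.2]
  have R_nonneg : ∀ y, 0 ≤ R y := fun y =>
    add_nonneg (mul_nonneg (by linarith [y.1.2.2]) (c_nonneg _)) (by linarith [y.1.2.1])
  have R_le_one : ∀ y, R y ≤ 1 := fun y => by
    have := mul_le_of_le_one_right (sub_nonneg.2 y.1.2.2) (c_le_one y.2.t)
    simp only [R]
    linarith [y.1.2.1]
  let l : C({ y // T y < 1 }, PathFib f) := PathFib.lift
    ⟨fun y => (y.1.2.fst (lt_one y y.2)).1.1,
      (_root_.continuous_fst.comp continuous_subtype_val).comp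
        (continuous_fst_comp (by fun_prop) _)⟩
    ⟨fun y => path y.1.1.2 (R y.1 * y.2), continuous_path_of_lt_one (by fun_prop) (by fun_prop)
      (fun y => lt_one _ y.1.2) fun y h =>
        (mul_le_of_le_one_right (R_nonneg _) y.2.2.2).trans (R_le _ h)⟩
    fun y => by simpa using path_zero (lt_one _ y.2)
  let r : C({ y // 0 < T y }, PathFib g) := PathFib.lift
    ⟨fun y => (y.1.2.snd (pos y y.2)).1.1,
      (_root_.continuous_fst.comp continuous_subtype_val).comp
        (continuous_snd_comp (by fun_prop) _)⟩
    ⟨fun y => path y.1.1.2 (1 - (1 - R y.1) * y.2), continuous_path_of_pos (by fun_prop)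
      (by fun_prop) (fun y => pos _ y.1.2) fun y h => by
        have := mul_le_of_le_one_right (sub_nonneg.2 (R_le_one y.1)) y.2.2.2
        linarith [R_ge _ h]⟩
    fun y => by simpa using path_one (pos _ y.2)
  let M : I × FibJoin (pathFib f) (pathFib g) → FibJoin (pathFib f) (pathFib g) := fun y =>
    { t := T y
      t_nonneg := add_nonneg (mul_nonneg (by linarith [y.1.2.2]) (c_nonneg _))
        (mul_nonneg y.1.2.1 y.2.t_nonneg)
      t_le_one := by
        have h₁ := mul_le_of_le_one_right (sub_nonneg.2 y.1.2.2) (c_le_one y.2.t)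
        have h₂ := mul_le_of_le_one_right y.1.2.1 y.2.t_le_one
        simp only [T]
        linarith
      fst := fun h => l ⟨y, h⟩
      snd := fun h => r ⟨y, h⟩
      comm := fun h h' => by
        change path y.2 (R y * (1 : I)) = path y.2 (1 - (1 - R y) * (1 : I))
        simp }
  have hM : Continuous M := continuous_of hT l.continuous r.continuous
  have T₀ : ∀ z, T (0, z) = c z.t := fun z => by simp [T]
  have R₀ : ∀ z, R (0, z) = c z.t := fun z => by simp [R]
  have T₁ : ∀ z, T (1, z) = z.t := fun z => by simp [T]
  have R₁ : ∀ z, R (1, z) = 1 / 2 := fun z => by simp [R]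
  refine ⟨⟨⟨M, hM⟩, fun z => ?_, fun z => ?_⟩⟩
  · change M (0, z) = ofPushout f g (toPushoutFun z)
    rcases lt_or_ge z.t (1 / 3) with h | h
    · rw [toPushoutFun_of_le z h.le]
      refine ext_of ((T₀ z).trans (c_le h.le)) (fun _ _ => PathFib.ext rfl fun s => ?_)
        fun _ h' => (lt_irrefl _ h').elim
      change path z (R (0, z) * s) = f _
      rw [R₀, c_le h.le, zero_mul, path_zero (by linarith)]
    rcases lt_or_ge (2 / 3) z.t with h₁ | h₁
    · rw [toPushoutFun_of_ge z h₁.le]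
      refine ext_of ((T₀ z).trans (c_ge h₁.le)) (fun _ h' => (lt_irrefl _ h').elim)
        fun _ _ => PathFib.ext rfl fun s => ?_
      change path z (1 - (1 - R (0, z)) * s) = g _
      rw [R₀, c_ge h₁.le, sub_self, zero_mul, sub_zero, path_one (by linarith)]
    rw [toPushoutFun_of_mem z ⟨by linarith, by linarith⟩]
    refine ext_of (T₀ z) (fun _ _ => PathFib.ext rfl fun s => ?_)
      fun _ _ => PathFib.ext rfl fun s => ?_
    · change path z (R (0, z) * s) = path z (clampI (c z.t * s))
      rw [R₀, coe_clampI, min_eq_right (mul_le_one₀ (c_le_one _) s.2.1 s.2.2),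
        max_eq_right (mul_nonneg (c_nonneg _) s.2.1)]
    · change path z (1 - (1 - R (0, z)) * s) = path z (clampI (1 - (1 - c z.t) * s))
      have h₂ := mul_nonneg (sub_nonneg.2 (c_le_one z.t)) s.2.1
      have h₃ := mul_le_one₀ (sub_le_self 1 (c_nonneg z.t)) s.2.1 s.2.2
      rw [R₀, coe_clampI, min_eq_right (by linarith), max_eq_right (by linarith)]
  · refine ext_of (T₁ z) (fun _ h => PathFib.ext rfl fun s => ?_)
      fun _ h => PathFib.ext rfl fun s => ?_
    · change path z (R (1, z) * s) = (z.fst h).1.2 s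
      rw [R₁, path_of_le (z := z) h (by linarith [s.2.2]),
        show 2 * (1 / 2 * (s : ℝ)) = s by ring, clampI_coe]
    · change path z (1 - (1 - R (1, z)) * s) = (z.snd h).1.2 s
      rw [R₁, path_of_ge (z := z) h (by linarith [s.2.2]),
        show 2 - 2 * (1 - (1 - 1 / 2) * (s : ℝ)) = s by ring, clampI_coe]

end FibJoin

variable {f g} {J : Type u} [TopologicalSpace J] {h : C(J, X)}

/-- Every join over `X` is homotopy equivalent over `X` to the fibrewise join of path fibrations. -/
theorem IsJoin.homotopyEquivOver (hh : IsJoin f g h) :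
    HomotopyEquivOver h (FibJoin.proj (pathFib f) (pathFib g)) := by
  obtain ⟨F, _, p, q, u, v, K, H, hK, hH, hw⟩ := hh
  have h₁ : HomotopyEquivOver (fromStdPushout K) h := ⟨_, hH, hw⟩
  have h₂ : HomotopyEquivOver (fromStdPushout K) (fromStdPushout (stdPullbackHomotopy f g)) :=
    ⟨StdPushout.mapMid (StdPullback.fst f g) (StdPullback.snd f g) (toStdPullback K),
      StdPushout.isHomotopyEquiv_mapMid _ _ hK, Homotopic.of_eq (by
        ext z
        induction z using StdPushout.ind <;> rfl)⟩
  have h₃ : HomotopyEquivOver (fromStdPushout (stdPullbackHomotopy f g))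
      (FibJoin.proj (pathFib f) (pathFib g)) :=
    ⟨FibJoin.ofPushout f g, isHomotopyEquiv_iff.2 ⟨FibJoin.toPushout f g,
      FibJoin.toPushout_comp_ofPushout f g, FibJoin.ofPushout_comp_toPushout f g⟩,
      Homotopic.of_eq (ContinuousMap.ext FibJoin.proj_ofPushout)⟩
  exact h₁.symm.trans (h₂.trans h₃)

end Comparison

/-! ### Iterated fibrewise joins and the Ganea maps -/

/-- A space over `X`. -/
structure OverSpace (X : Type u) [TopologicalSpace X] where
  /-- The total space. -/
  carrier : Type u
  [top : TopologicalSpace carrier]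
  /-- The projection. -/
  map : C(carrier, X)

attribute [instance] OverSpace.top

namespace OverSpace

variable {X : Type u} [TopologicalSpace X]

/-- The fibrewise join of spaces over `X`. -/
noncomputable def join (P Q : OverSpace X) : OverSpace X :=
  ⟨FibJoin P.map Q.map, FibJoin.proj P.map Q.map⟩

/-- The `n`-fold iterated join of `P` with itself, counting from `pow P 0 = P`. -/
noncomputable def pow (P : OverSpace X) : ℕ → OverSpace X
  | 0 => P
  | n + 1 => join (pow P n) P

theorem isFib_pow {P : OverSpace X} (hP : IsFib P.map) : ∀ n, IsFib (pow P n).map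
  | 0 => hP
  | n + 1 => (isFib_pow hP n).fibJoin hP

/-- `pow P k` has `k + 1` factors, whence the shift by one. The inductive step is associativity;
before joining with one more `P`, Dold's theorem upgrades the induction hypothesis to a fibre
homotopy equivalence. -/
theorem join_pow_pow {P : OverSpace X} (hP : IsFib P.map) (m n : ℕ) :
    HomotopyEquivOver (join (pow P m) (pow P n)).map (pow P (m + n + 1)).map := by
  induction n with
  | zero => exact .refl _
  | succ n ih =>
    have h₁ : HomotopyEquivOver (join (join (pow P m) (pow P n)) P).map
        (join (pow P m) (pow P (n + 1))).map :=
      (FibJoin.fibEquiv_assoc (pow P m).map (pow P n).map P.map).homotopyEquivOver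
    have h₂ := IsFib.fibEquiv ((isFib_pow hP m).fibJoin (isFib_pow hP n))
      (isFib_pow hP (m + n + 1)) ih
    exact h₁.symm.trans (h₂.fibJoin (FibEquiv.refl P.map)).homotopyEquivOver

theorem pow_pow {P : OverSpace X} (hP : IsFib P.map) (i j : ℕ) :
    HomotopyEquivOver (pow (pow P i) j).map (pow P (i * j + i + j)).map := by
  induction j with
  | zero =>
    have e : i * 0 + i + 0 = i := by ring
    rw [e]
    exact .refl (pow P i).map
  | succ j ih =>
    have h := IsFib.fibEquiv (p := (pow (pow P i) j).map) (p' := (pow P (i * j + i + j)).map)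
      (isFib_pow (isFib_pow hP i) j) (isFib_pow hP _) ih
    have e : i * (j + 1) + i + (j + 1) = i * j + i + j + i + 1 := by ring
    rw [e]
    exact (h.fibJoin (FibEquiv.refl (pow P i).map)).homotopyEquivOver.trans (join_pow_pow hP _ i)

end OverSpace

section

variable {A B J X : Type u} [TopologicalSpace A] [TopologicalSpace B] [TopologicalSpace J]
  [TopologicalSpace X]

/-- Joins over `X` may be computed from any replacements of the given maps by fibrations. -/
theorem IsJoin.homotopyEquivOver_fibJoin {E E' : Type u} [TopologicalSpace E]
    [TopologicalSpace E'] {f : C(A, X)} {g : C(B, X)} {h : C(J, X)} {p : C(E, X)} {q : C(E', X)}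
    (hh : IsJoin f g h) (hp : IsFib p) (hq : IsFib q) (hf : HomotopyEquivOver f p)
    (hg : HomotopyEquivOver g q) : HomotopyEquivOver h (FibJoin.proj p q) :=
  hh.homotopyEquivOver.trans <| FibEquiv.homotopyEquivOver <|
    ((isFib_pathFib f).fibEquiv hp ((homotopyEquivOver_pathFib f).trans hf)).fibJoin
      ((isFib_pathFib g).fibEquiv hq ((homotopyEquivOver_pathFib g).trans hg))

/-- Any fibration equivalent to `ι` is allowed, not just its path fibration: for the Ganea maps of
`g_i` the replacement used is the iterated join `pow P i`. -/
theorem IsGaneaMap.homotopyEquivOver_pow {ι : C(A, X)} {P : OverSpace X} (hP : IsFib P.map)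
    (h : HomotopyEquivOver ι P.map) {n : ℕ} {G : Type u} [TopologicalSpace G] {g : C(G, X)}
    (hg : IsGaneaMap ι n g) : HomotopyEquivOver g (P.pow n).map := by
  induction hg with
  | zero => exact h
  | succ _ hj ih => exact hj.homotopyEquivOver_fibJoin (OverSpace.isFib_pow hP _) hP ih h

end

end Ganea

theorem mainTheorem7 {A X : Type u} [TopologicalSpace A] [TopologicalSpace X] (ι : C(A, X))
    (i j : ℕ)
    {G : Type u} [TopologicalSpace G] (gi : C(G, X)) (hgi : Ganea.IsGaneaMap ι i gi)
    {G' : Type u} [TopologicalSpace G'] (gj : C(G', X)) (hgj : Ganea.IsGaneaMap gi j gj)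
    {G'' : Type u} [TopologicalSpace G''] (gk : C(G'', X))
    (hgk : Ganea.IsGaneaMap ι (i * j + i + j) gk) :
    Ganea.HomotopyEquivOver gj gk := by
  let P : Ganea.OverSpace X := ⟨Ganea.PathFib ι, Ganea.pathFib ι⟩
  have hP : Ganea.IsFib P.map := Ganea.isFib_pathFib ι
  have hι : Ganea.HomotopyEquivOver ι P.map := (Ganea.homotopyEquivOver_pathFib ι).symm
  exact (hgj.homotopyEquivOver_pow (Ganea.OverSpace.isFib_pow hP i)
    (hgi.homotopyEquivOver_pow hP hι)).trans
      ((Ganea.OverSpace.pow_pow hP i j).trans (hgk.homotopyEquivOver_pow hP hι).symm)
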